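/- Let $k\ge 1$ be an integer that is not a prime power (the value $k=1$ is allowed), let $q=2^k$, let $\varphi:x\mapsto x^2$ be the Frobenius automorphism of $\mathbb F_q$, and let $\Gamma L(2,q)=GL(2,q)\rtimes\langle\varphi\rangle=\{A\varphi^i: A\in GL(2,q),\ 0\le i\le k-1\}$ act on the set $\Omega$ of non-zero vectors of $\mathbb F_q^2$ by $(A\varphi^i)v=Av^{\varphi^i}$. Call $\mathcal F\subseteq \Gamma L(2,q)$ intersecting if for all $g,h\in\mathcal F$ there is $w\in\Omega$ with $g(w)=h(w)$. Then $\Gamma L(2,q)$ has the EKR property: every intersecting set has size at most that of the stabilizer of a point of $\Omega$. The largest size of an intersecting set is $kq(q-1)$. Let moreover $\omega$ be a primitive element of $\mathbb F_q$ and, for $0\le i,t\le q-2$ and $0\le j\le k-1$, let $$V_{i,j}=\left\{\omega^i\varphi^j\begin{bmatrix}1&z\\0&y\end{bmatrix}: z\in\mathbb F_q,\ y\in\mathbb F_q^*\right\},\qquad H_{t,j}=\left\{\varphi^j\begin{bmatrix}x&z\\0&\omega^t\end{bmatrix}: x\in\mathbb F_q^*,\ z\in\mathbb F_q\right\}.$$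 Let $\mathcal H_q$ be the subgroup of all $A\varphi^j$ with $A\in GL(2,q)$ upper triangular. If $\mathcal F$ is an intersecting set of maximum size and $f\in\mathcal F$, then some conjugate $g f^{-1}\mathcal F g^{-1}$, $g\in\Gamma L(2,q)$, of the intersecting set $f^{-1}\mathcal F$, which contains the identity, is of one of the two types below. Moreover, the intersecting sets of maximum size that contain the identity and are contained in $\mathcal H_q$ are exactly the sets of these two types: 1. Vertical type: $V_{0,0}\cup V_{r_1,1}\cup\dots\cup V_{r_{k-1},k-1}$, where $r_0=0$, $0\le r_j\le q-2$ for $0\le j\le k-1$, and for all $0\le j<j'\le k-1$ either $\gcd(j'-j,k)=1$ or $r_j\equiv r_{j'} \pmod{2^{j'-j}-1}$. 2. Horizontal type: $H_{0,0}\cup H_{t_1,1}\cup\dots\cup H_{t_{k-1},k-1}$, where $t_0=0$, $0\le t_j\le q-2$ for $0\le j\le k-1$, and for all $0\le j<j'\le k-1$ either $\gcd(j'-j,k)=1$ or $t_j\equiv t_{j'} \pmod{2^{j'-j}-1}$. Here the indices are exponents of $\omega$, so these congruences are between elements of $\mathbb Z/(q-1)\mathbb Z$: $a\equiv b\pmod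 m$ means that $a-b\in m\mathbb Z+(q-1)\mathbb Z$. -/

import Mathlib

open scoped Matrix

namespace SemilinearEKR

/-! ### Intersecting sets and the EKR property of a finite group acting on a set -/

section EKR

variable {G : Type*} (Ω : Type*) [Group G] [MulAction G Ω]

/-- Any two elements of `S` agree on some point of `Ω`. -/
def IsIntersecting (S : Set G) : Prop :=
  ∀ g ∈ S, ∀ h ∈ S, ∃ w : Ω, g • w = h • w

/-- An intersecting set of largest possible size. -/
def IsMaximumIntersecting [Finite G] (S : Set G) : Prop :=
  IsIntersecting Ω S ∧ ∀ T : Set G, IsIntersecting Ω T → T.ncard ≤ S.ncard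

variable (G)

/-- No intersecting set is larger than a point stabilizer. -/
def HasEKR [Finite G] : Prop :=
  ∀ S : Set G, IsIntersecting Ω S →
    ∀ w : Ω, S.ncard ≤ Nat.card (MulAction.stabilizer G w)

end EKR

/-! ### The general semilinear group of degree two -/

noncomputable section

/-- The action of field automorphisms on `GL(2, F)`, entry by entry. -/
def entrywise (F : Type*) [Field F] : RingAut F →* MulAut (GL (Fin 2) F) where
  toFun σ :=
    { toFun := Matrix.GeneralLinearGroup.map (σ : F →+* F)
      invFun := Matrix.GeneralLinearGroup.map (σ.symm : F →+* F)
      left_inv := fun A => by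
        ext i j
        simp [Matrix.GeneralLinearGroup.map_apply]
      right_inv := fun A => by
        ext i j
        simp [Matrix.GeneralLinearGroup.map_apply]
      map_mul' := fun A B => map_mul _ A B }
  map_one' := by
    ext A i j
    simp [Matrix.GeneralLinearGroup.map_apply]
  map_mul' σ τ := by
    ext A i j
    simp [Matrix.GeneralLinearGroup.map_apply]

variable (p : ℕ) [Fact p.Prime] (F : Type*) [Field F] [Finite F] [CharP F p]

/-- The Frobenius automorphism `x ↦ x ^ p`. -/
abbrev frob : RingAut F := frobeniusEquiv F p

/-- The general semilinear group `GL(2, F) ⋊ ⟨frob⟩`. -/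
abbrev GammaL : Type _ :=
  GL (Fin 2) F ⋊[(entrywise F).comp (Subgroup.zpowers (frob p F)).subtype]
    Subgroup.zpowers (frob p F)

instance : Finite (RingAut F) :=
  Finite.of_injective (fun σ : RingAut F => (σ : F → F)) DFunLike.coe_injective

instance : Finite (GammaL p F) :=
  Finite.of_equiv _ SemidirectProduct.equivProd.symm

/-- The non-zero vectors of `F²`. -/
abbrev NonzeroVec (F : Type*) [Field F] : Type _ := {v : Fin 2 → F // v ≠ 0}

variable {p F}

/-- The semilinear map `v ↦ A v^σ` of `F²` given by `A σ`. -/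
def semilin (g : GammaL p F) (v : Fin 2 → F) : Fin 2 → F :=
  (g.left : Matrix (Fin 2) (Fin 2) F) *ᵥ (fun i => (g.right : RingAut F) (v i))

theorem semilin_one (v : Fin 2 → F) : semilin (1 : GammaL p F) v = v := by
  simp [semilin]

theorem semilin_mul (g h : GammaL p F) (v : Fin 2 → F) :
    semilin (g * h) v = semilin g (semilin h v) := by
  ext i
  simp [semilin, entrywise, Matrix.mulVec, dotProduct, Matrix.mul_apply, Fin.sum_univ_two]
  ring

theorem semilin_zero (g : GammaL p F) : semilin g (0 : Fin 2 → F) = 0 := by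
  ext i
  simp [semilin, Matrix.mulVec, dotProduct]

instance : MulAction (GammaL p F) (NonzeroVec F) where
  smul g v := ⟨semilin g v, fun h => v.2 <| by
    have h' := congrArg (semilin g⁻¹) h
    rwa [← semilin_mul, inv_mul_cancel, semilin_one, semilin_zero] at h'⟩
  one_smul v := Subtype.ext (semilin_one v.1)
  mul_smul g h v := Subtype.ext (semilin_mul g h v.1)

/-! ### Upper triangular elements, vertical and horizontal sets -/

/-- The matrix with rows `(x, z)` and `(0, y)`. -/
def upper (x y : Fˣ) (z : F) : GL (Fin 2) F :=
  Matrix.GeneralLinearGroup.mkOfDetNeZero !![(x : F), z; 0, (y : F)]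
    (by simp [Matrix.det_fin_two_of])

variable (p)

/-- A matrix as an element of the semilinear group. -/
def ofGL (A : GL (Fin 2) F) : GammaL p F := SemidirectProduct.inl A

variable (F)

/-- The element `φ ^ j` of the semilinear group. -/
def phiPow (j : ℕ) : GammaL p F :=
  SemidirectProduct.inr (⟨frob p F, Subgroup.mem_zpowers _⟩ ^ j)

/-- The elements `A φ ^ j` with `A` upper triangular: those that leave the line spanned by the
first basis vector invariant. -/
def upperTriangular : Set (GammaL p F) :=
  {g | ∃ (x y : Fˣ) (z : F) (j : ℕ), g = ofGL p (upper x y z) * phiPow p F j}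

variable {F}

/-- `V_{i,j}`; the scalar `ω ^ i` is the scalar matrix. -/
def V (ω : Fˣ) (i j : ℕ) : Set (GammaL p F) :=
  {g | ∃ (z : F) (y : Fˣ),
    g = ofGL p (Matrix.GeneralLinearGroup.scalar (Fin 2) (ω ^ i)) * phiPow p F j
      * ofGL p (upper 1 y z)}

/-- `H_{t,j}`. -/
def H (ω : Fˣ) (t j : ℕ) : Set (GammaL p F) :=
  {g | ∃ (x : Fˣ) (z : F), g = phiPow p F j * ofGL p (upper x (ω ^ t) z)}

end

/-- The conditions on the exponents `r 0, …, r (k - 1)` of a primitive element of the field of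
order `2 ^ k`. Such exponents live in `ℤ/(2 ^ k - 1)`, and their congruence modulo
`2 ^ (j' - j) - 1` is the congruence in that ring; for integers it is the congruence
modulo `gcd (2 ^ (j' - j) - 1) (2 ^ k - 1)`. -/
def Admissible (k : ℕ) (r : ℕ → ℕ) : Prop :=
  r 0 = 0 ∧ (∀ j < k, r j ≤ 2 ^ k - 2) ∧
    ∀ j j' : ℕ, j < j' → j' < k →
      Nat.gcd (j' - j) k = 1 ∨
        ((2 : ZMod (2 ^ k - 1)) ^ (j' - j) - 1) ∣ ((r j' : ZMod (2 ^ k - 1)) - r j)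

section

variable {F : Type*} [Field F] [Finite F] [CharP F 2]

/-- `S = V_{0,0} ∪ V_{r 1,1} ∪ … ∪ V_{r (k-1),k-1}` with admissible exponents. -/
def IsVerticalType (k : ℕ) (ω : Fˣ) (S : Set (GammaL 2 F)) : Prop :=
  ∃ r : ℕ → ℕ, Admissible k r ∧ S = ⋃ j ∈ Finset.range k, V 2 ω (r j) j

/-- `S = H_{0,0} ∪ H_{t 1,1} ∪ … ∪ H_{t (k-1),k-1}` with admissible exponents. -/
def IsHorizontalType (k : ℕ) (ω : Fˣ) (S : Set (GammaL 2 F)) : Prop :=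
  ∃ t : ℕ → ℕ, Admissible k t ∧ S = ⋃ j ∈ Finset.range k, H 2 ω (t j) j

end

end SemilinearEKR

/-!
For a fixed field automorphism, the condition that `A σ` and `B σ` agree somewhere is
`det (A - B) = 0`. A set of matrices whose differences are singular has a common kernel or a common
kernel of the adjugates, so each fiber of an intersecting set over the group of field automorphisms
lies in a transporter `{g | g v = u}` or in the image of one under `A σ ↦ (det A)⁻¹ A σ`. This gives
the bound, and in a maximum intersecting set every fiber is of one of these two forms.

When `ρ` fixes a unit other than `1`, some scalar multiple of `ρ` is a derangement. Multiplying it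
by suitable matrices separates the fibers over `σ` and `σ ρ` unless both have the same form and the
same line. For `p = 2` and `k` not a prime power, and for odd `p` and any `k`, every field
automorphism is a product of two such `ρ`, so all fibers share the form and the line of the fiber
over `1`. Once the line is that of `e₁`, a fiber is determined by the factor `ω ^ i` by which it
scales `e₁`, and two fibers agree precisely when an equation `ω ^ m * y = ω ^ n * y ^ (p ^ d)` is
solvable, which is the congruence on the exponents.
-/

namespace SemilinearEKR

/-! ### Vectors and matrices of size two -/

section Plane

variable {F : Type*} [Field F]

/-- The determinant of the matrix with columns `u` and `v`; it vanishes exactly when `u` and `v`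
are proportional. -/
def det₂ (u v : Fin 2 → F) : F := u 0 * v 1 - u 1 * v 0

/-- The first basis vector, which spans the line fixed by the upper triangular elements. -/
abbrev e₁ : Fin 2 → F := ![1, 0]

theorem e₁_ne_zero : (e₁ : Fin 2 → F) ≠ 0 := fun h => one_ne_zero (congrFun h 0)

theorem det₂_self (u : Fin 2 → F) : det₂ u u = 0 := by
  simp only [det₂]; ring

theorem det₂_comm (u v : Fin 2 → F) : det₂ u v = -det₂ v u := by
  simp only [det₂]; ring

theorem det₂_smul_right (a : F) (u v : Fin 2 → F) : det₂ u (a • v) = a * det₂ u v := by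
  simp only [det₂, Pi.smul_apply, smul_eq_mul]; ring

theorem det₂_smul_left (a : F) (u v : Fin 2 → F) : det₂ (a • u) v = a * det₂ u v := by
  simp only [det₂, Pi.smul_apply, smul_eq_mul]; ring

theorem det₂_mulVec (M : Matrix (Fin 2) (Fin 2) F) (u v : Fin 2 → F) :
    det₂ (M *ᵥ u) (M *ᵥ v) = M.det * det₂ u v := by
  simp only [det₂, Matrix.mulVec, dotProduct, Fin.sum_univ_two, Matrix.det_fin_two]; ring

theorem det₂_smul_eq_sub (u v w : Fin 2 → F) :
    det₂ u v • w = det₂ w v • u - det₂ w u • v := by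
  ext i
  fin_cases i <;>
    simp only [det₂, Fin.zero_eta, Fin.mk_one, Pi.smul_apply, Pi.sub_apply, smul_eq_mul] <;> ring

theorem exists_det₂_ne_zero {u : Fin 2 → F} (hu : u ≠ 0) : ∃ v, det₂ u v ≠ 0 := by
  obtain ⟨i, hi⟩ := Function.ne_iff.mp hu
  fin_cases i
  · exact ⟨![0, 1], by simpa [det₂] using hi⟩
  · exact ⟨![1, 0], by simpa [det₂] using hi⟩

theorem exists_eq_smul_of_det₂_eq_zero {u v : Fin 2 → F} (hu : u ≠ 0) (h : det₂ u v = 0) :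
    ∃ a : F, v = a • u := by
  obtain ⟨w, hw⟩ := exists_det₂_ne_zero hu
  have hcramer := det₂_smul_eq_sub u w v
  rw [det₂_comm v u, h, neg_zero, zero_smul, sub_zero] at hcramer
  exact ⟨(det₂ u w)⁻¹ * det₂ v w, by rw [mul_smul, ← hcramer, inv_smul_smul₀ hw]⟩

theorem exists_eq_units_smul_of_det₂_eq_zero {u v : Fin 2 → F} (hu : u ≠ 0) (hv : v ≠ 0)
    (h : det₂ u v = 0) : ∃ b : Fˣ, v = b • u := by
  obtain ⟨a, rfl⟩ := exists_eq_smul_of_det₂_eq_zero hu h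
  exact ⟨Units.mk0 a (left_ne_zero_of_smul hv), rfl⟩

theorem exists_GL_mulVec_pair {a b a' b' : Fin 2 → F} (h : det₂ a b ≠ 0) (h' : det₂ a' b' ≠ 0) :
    ∃ A : GL (Fin 2) F, A.val *ᵥ a = a' ∧ A.val *ᵥ b = b' := by
  let M (c d : Fin 2 → F) : Matrix (Fin 2) (Fin 2) F := !![c 0, d 0; c 1, d 1]
  have hM (c d : Fin 2 → F) : (M c d).det = det₂ c d := by
    simp only [M, Matrix.det_fin_two_of, det₂]; ring
  have hM₀ (c d : Fin 2 → F) : M c d *ᵥ ![1, 0] = c := by ext i; fin_cases i <;> simp [M]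
  have hM₁ (c d : Fin 2 → F) : M c d *ᵥ ![0, 1] = d := by ext i; fin_cases i <;> simp [M]
  have hu : IsUnit (M a b).det := (hM a b ▸ h).isUnit
  have hinv (v : Fin 2 → F) : (M a b)⁻¹ *ᵥ (M a b *ᵥ v) = v := by
    rw [Matrix.mulVec_mulVec, Matrix.nonsing_inv_mul _ hu, Matrix.one_mulVec]
  refine ⟨Matrix.GeneralLinearGroup.mkOfDetNeZero (M a' b' * (M a b)⁻¹) ?_, ?_, ?_⟩
  · rw [Matrix.det_mul, Matrix.det_nonsing_inv, hM, hM]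
    rw [Ring.inverse_eq_inv']
    exact mul_ne_zero h' (inv_ne_zero h)
  · change (M a' b' * (M a b)⁻¹) *ᵥ a = a'
    rw [← Matrix.mulVec_mulVec]
    nth_rw 2 [← hM₀ a b]
    rw [hinv, hM₀]
  · change (M a' b' * (M a b)⁻¹) *ᵥ b = b'
    rw [← Matrix.mulVec_mulVec]
    nth_rw 2 [← hM₁ a b]
    rw [hinv, hM₁]

theorem exists_eq_vecMulVec_of_det_eq_zero {M : Matrix (Fin 2) (Fin 2) F} (h : M.det = 0) :
    ∃ x y : Fin 2 → F, M = Matrix.vecMulVec x y := by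
  by_cases h₀ : M 0 = 0
  · refine ⟨![0, 1], M 1, ?_⟩
    ext i j; fin_cases i <;> simp [Matrix.vecMulVec_apply, h₀]
  · have hrows : det₂ (M 0) (M 1) = 0 := by
      rw [← h, Matrix.det_fin_two, det₂]
    obtain ⟨a, ha⟩ := exists_eq_smul_of_det₂_eq_zero h₀ hrows
    refine ⟨![1, a], M 0, ?_⟩
    ext i j; fin_cases i <;> simp [Matrix.vecMulVec_apply, ha]

theorem det_vecMulVec_sub_vecMulVec (x y x' y' : Fin 2 → F) :
    (Matrix.vecMulVec x y - Matrix.vecMulVec x' y').det = -(det₂ x x' * det₂ y y') := by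
  simp only [Matrix.det_fin_two, Matrix.sub_apply, Matrix.vecMulVec_apply, det₂]; ring

theorem vecMulVec_mulVec_eq_zero_iff {x : Fin 2 → F} (hx : x ≠ 0) (y w : Fin 2 → F) :
    Matrix.vecMulVec x y *ᵥ w = 0 ↔ y ⬝ᵥ w = 0 := by
  rw [Matrix.vecMulVec_mulVec, op_smul_eq_smul, smul_eq_zero_iff_left hx]

theorem adjugate_vecMulVec_mulVec_eq_zero_iff (x : Fin 2 → F) {y : Fin 2 → F} (hy : y ≠ 0)
    (w : Fin 2 → F) : (Matrix.vecMulVec x y).adjugate *ᵥ w = 0 ↔ det₂ x w = 0 := by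
  have hadj : (Matrix.vecMulVec x y).adjugate *ᵥ w = det₂ x w • ![-y 1, y 0] := by
    ext i
    fin_cases i <;>
      simp [Matrix.adjugate_fin_two, Matrix.vecMulVec_apply, Matrix.mulVec, dotProduct,
        Fin.sum_univ_two, det₂] <;> ring
  have hy' : ![-y 1, y 0] ≠ 0 := fun h => hy <| by
    ext i
    fin_cases i
    · exact congrFun h 1
    · exact neg_eq_zero.mp (congrFun h 0)
  rw [hadj, smul_eq_zero_iff_left hy']

theorem ker_eq_or_ker_adjugate_eq {M N : Matrix (Fin 2) (Fin 2) F} (hM : M ≠ 0) (hN : N ≠ 0)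
    (hMdet : M.det = 0) (hNdet : N.det = 0) (hMN : (M - N).det = 0) :
    {v | M *ᵥ v = 0} = {v | N *ᵥ v = 0} ∨
      {v | M.adjugate *ᵥ v = 0} = {v | N.adjugate *ᵥ v = 0} := by
  obtain ⟨x, y, rfl⟩ := exists_eq_vecMulVec_of_det_eq_zero hMdet
  obtain ⟨x', y', rfl⟩ := exists_eq_vecMulVec_of_det_eq_zero hNdet
  obtain ⟨hx, hy⟩ : x ≠ 0 ∧ y ≠ 0 := by rwa [Ne, Matrix.vecMulVec_eq_zero, not_or] at hM
  obtain ⟨hx', hy'⟩ : x' ≠ 0 ∧ y' ≠ 0 := by rwa [Ne, Matrix.vecMulVec_eq_zero, not_or] at hN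
  rw [det_vecMulVec_sub_vecMulVec, neg_eq_zero, mul_eq_zero] at hMN
  obtain h | h := hMN
  · right
    obtain ⟨b, rfl⟩ := exists_eq_units_smul_of_det₂_eq_zero hx hx' h
    ext w
    simp only [Set.mem_ofPred_eq, adjugate_vecMulVec_mulVec_eq_zero_iff _ hy,
      adjugate_vecMulVec_mulVec_eq_zero_iff _ hy', Units.smul_def, det₂_smul_left, mul_eq_zero,
      b.ne_zero, false_or]
  · left
    obtain ⟨b, rfl⟩ := exists_eq_units_smul_of_det₂_eq_zero hy hy' h
    ext w
    simp only [Set.mem_ofPred_eq, vecMulVec_mulVec_eq_zero_iff hx,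
      vecMulVec_mulVec_eq_zero_iff hx', Units.smul_def, smul_dotProduct, smul_eq_mul, mul_eq_zero,
      b.ne_zero, false_or]

theorem adjugate_sub_fin_two (M N : Matrix (Fin 2) (Fin 2) F) :
    (M - N).adjugate = M.adjugate - N.adjugate := by
  ext i j
  fin_cases i <;> fin_cases j <;> simp [Matrix.adjugate_fin_two] <;> ring

theorem forall_eq_or_forall_eq {ι α β : Type*} {f : ι → α} {g : ι → β}
    (h : ∀ i j, f i = f j ∨ g i = g j) : (∀ i j, f i = f j) ∨ ∀ i j, g i = g j := by
  by_contra! hne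
  obtain ⟨⟨i, j, hf⟩, k, l, hg⟩ := hne
  grind [h i j, h k l, h i k, h j k, h i l, h j l]

theorem exists_common_kernel {𝒩 : Set (Matrix (Fin 2) (Fin 2) F)} (h₀ : 0 ∈ 𝒩)
    (h : ∀ M ∈ 𝒩, ∀ N ∈ 𝒩, (M - N).det = 0) :
    ∃ v ≠ 0, (∀ M ∈ 𝒩, M *ᵥ v = 0) ∨ ∀ M ∈ 𝒩, M.adjugate *ᵥ v = 0 := by
  have hdet (M) (hM : M ∈ 𝒩) : M.det = 0 := by simpa using h M hM 0 h₀
  by_cases hall : ∀ M ∈ 𝒩, M = 0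
  · refine ⟨e₁, e₁_ne_zero, .inl fun M hM => ?_⟩
    rw [hall M hM, Matrix.zero_mulVec]
  push Not at hall
  obtain ⟨N, hN, hN0⟩ := hall
  have hpair := forall_eq_or_forall_eq (ι := {M // M ∈ 𝒩 ∧ M ≠ 0})
    fun M M' => ker_eq_or_ker_adjugate_eq M.2.2 M'.2.2 (hdet _ M.2.1) (hdet _ M'.2.1)
      (h _ M.2.1 _ M'.2.1)
  obtain hker | hker := hpair
  · obtain ⟨v, hv, hNv⟩ := Matrix.exists_mulVec_eq_zero_iff.mpr (hdet N hN)
    refine ⟨v, hv, .inl fun M hM => ?_⟩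
    obtain rfl | hM0 := eq_or_ne M 0
    · exact Matrix.zero_mulVec v
    · exact (Set.ext_iff.mp (hker ⟨M, hM, hM0⟩ ⟨N, hN, hN0⟩) v).mpr hNv
  · have hadj : N.adjugate.det = 0 := by rw [Matrix.det_adjugate, hdet N hN]; simp
    obtain ⟨v, hv, hNv⟩ := Matrix.exists_mulVec_eq_zero_iff.mpr hadj
    refine ⟨v, hv, .inr fun M hM => ?_⟩
    obtain rfl | hM0 := eq_or_ne M 0
    · rw [Matrix.adjugate_zero, Matrix.zero_mulVec]
    · exact (Set.ext_iff.mp (hker ⟨M, hM, hM0⟩ ⟨N, hN, hN0⟩) v).mpr hNv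

end Plane

section Semilinear

variable {p : ℕ} [Fact p.Prime] {F : Type*} [Field F] [Finite F] [CharP F p]

attribute [local instance] Units.mulDistribMulActionRight

/-! ### Semilinear maps and the determinant twist -/

variable (p F) in
/-- The group generated by the Frobenius automorphism. It acts on scalars, on units and on vectors
through Mathlib's actions of automorphisms, so `σ • x` is the image of `x` under `σ`. -/
abbrev FrobGroup : Type _ := Subgroup.zpowers (frob p F)

theorem smul_e₁ (σ : FrobGroup p F) : σ • (e₁ : Fin 2 → F) = e₁ := by
  ext i; fin_cases i <;> simp

theorem det₂_smul (σ : FrobGroup p F) (u v : Fin 2 → F) :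
    det₂ (σ • u) (σ • v) = σ • det₂ u v := by
  simp only [det₂, Pi.smul_apply, smul_sub, smul_mul']

theorem semilin_eq_mulVec_smul (g : GammaL p F) (v : Fin 2 → F) :
    semilin g v = g.left.val *ᵥ (g.right • v) := rfl

theorem semilin_add (g : GammaL p F) (u v : Fin 2 → F) :
    semilin g (u + v) = semilin g u + semilin g v := by
  rw [semilin_eq_mulVec_smul, smul_add, Matrix.mulVec_add]; rfl

theorem semilin_smul (g : GammaL p F) (a : F) (v : Fin 2 → F) :
    semilin g (a • v) = (g.right • a) • semilin g v := by
  have hsmul : g.right • (a • v) = (g.right • a) • (g.right • v) :=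
    funext fun i => smul_mul' g.right a (v i)
  rw [semilin_eq_mulVec_smul, hsmul, Matrix.mulVec_smul]; rfl

theorem semilin_units_smul (g : GammaL p F) (a : Fˣ) (v : Fin 2 → F) :
    semilin g (a • v) = (g.right • a) • semilin g v :=
  semilin_smul g a v

theorem semilin_inv_eq_iff {g : GammaL p F} {u v : Fin 2 → F} :
    semilin g⁻¹ v = u ↔ semilin g u = v := by
  constructor
  · rintro rfl; rw [← semilin_mul, mul_inv_cancel, semilin_one]
  · rintro rfl; rw [← semilin_mul, inv_mul_cancel, semilin_one]

theorem semilin_injective (g : GammaL p F) : Function.Injective (semilin g) := fun u v h => by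
  rw [← semilin_inv_eq_iff.mpr h, ← semilin_mul, inv_mul_cancel, semilin_one]

theorem semilin_ne_zero (g : GammaL p F) {v : Fin 2 → F} (hv : v ≠ 0) : semilin g v ≠ 0 := fun h =>
  hv (semilin_injective g (h.trans (semilin_zero g).symm))

theorem det₂_semilin (g : GammaL p F) (u v : Fin 2 → F) :
    det₂ (semilin g u) (semilin g v) = g.left.det * g.right • det₂ u v := by
  rw [semilin_eq_mulVec_smul, semilin_eq_mulVec_smul, det₂_mulVec, det₂_smul]; rfl

theorem semilin_ext {g h : GammaL p F} (hright : g.right = h.right)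
    (hsemilin : ∀ v, semilin g v = semilin h v) : g = h := by
  refine SemidirectProduct.ext (Units.ext (Matrix.mulVec_injective (funext fun v => ?_))) hright
  simpa only [semilin_eq_mulVec_smul, hright, smul_inv_smul] using hsemilin (h.right⁻¹ • v)

theorem exists_semilin_pair (σ : FrobGroup p F) {u v u' v' : Fin 2 → F} (h : det₂ u v ≠ 0)
    (h' : det₂ u' v' ≠ 0) :
    ∃ g : GammaL p F, g.right = σ ∧ semilin g u = u' ∧ semilin g v = v' := by
  have hσ : det₂ (σ • u) (σ • v) ≠ 0 := by rwa [det₂_smul, smul_ne_zero_iff_ne]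
  obtain ⟨A, hu, hv⟩ := exists_GL_mulVec_pair hσ h'
  exact ⟨⟨A, σ⟩, rfl, hu, hv⟩

theorem exists_semilin (σ : FrobGroup p F) {u v : Fin 2 → F} (hu : u ≠ 0) (hv : v ≠ 0) :
    ∃ g : GammaL p F, g.right = σ ∧ semilin g u = v := by
  obtain ⟨u', hu'⟩ := exists_det₂_ne_zero hu
  obtain ⟨v', hv'⟩ := exists_det₂_ne_zero hv
  obtain ⟨g, hg, hgu, -⟩ := exists_semilin_pair σ hu' hv'
  exact ⟨g, hg, hgu⟩

section DetTwist

open Matrix.GeneralLinearGroup (scalar scalar_commute map_scalar map_det)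

/-- The involutive automorphism `A σ ↦ (det A)⁻¹ A σ`. Up to an inner automorphism it is
`A σ ↦ A⁻ᵀ σ`, the action on the dual plane, so it exchanges vertical and horizontal sets. -/
noncomputable def detTwist : GammaL p F →* GammaL p F :=
  SemidirectProduct.map
    { toFun := fun A => scalar (Fin 2) A.det⁻¹ * A
      map_one' := by simp
      map_mul' := fun A B => by
        rw [map_mul, mul_inv, map_mul]
        exact Commute.mul_mul_mul_comm (scalar_commute B.det⁻¹ A) _ _ }
    (MonoidHom.id _) fun σ => by
      ext A : 1
      change scalar (Fin 2) (Matrix.GeneralLinearGroup.map _ A).det⁻¹ * _ =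
        Matrix.GeneralLinearGroup.map _ (scalar (Fin 2) A.det⁻¹ * A)
      rw [map_mul, map_scalar, map_det, map_inv]
      rfl

theorem detTwist_right (g : GammaL p F) : (detTwist g).right = g.right := rfl

theorem det_detTwist_left (g : GammaL p F) : (detTwist g).left.det = g.left.det⁻¹ := by
  change (scalar (Fin 2) g.left.det⁻¹ * g.left).det = _
  rw [map_mul, Matrix.GeneralLinearGroup.det_scalar, Fintype.card_fin]
  group

theorem semilin_detTwist (g : GammaL p F) (v : Fin 2 → F) :
    semilin (detTwist g) v = g.left.det⁻¹ • semilin g v := by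
  change (Matrix.scalar (Fin 2) (g.left.det⁻¹).val * g.left.val) *ᵥ _ = _
  rw [Matrix.scalar_apply, ← Matrix.smul_eq_diagonal_mul, Matrix.smul_mulVec]
  rfl

theorem detTwist_involutive : Function.Involutive (detTwist : GammaL p F → GammaL p F) := fun g =>
  semilin_ext rfl fun v => by
    rw [semilin_detTwist, det_detTwist_left, semilin_detTwist, inv_inv, smul_inv_smul]

end DetTwist

/-- The semilinear maps `g` and `h` have the same value at some non-zero vector. -/
def Agree (g h : GammaL p F) : Prop :=
  ∃ v : Fin 2 → F, v ≠ 0 ∧ semilin g v = semilin h v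

theorem Agree.symm {g h : GammaL p F} : Agree g h → Agree h g := fun ⟨v, hv, hgh⟩ =>
  ⟨v, hv, hgh.symm⟩

theorem isIntersecting_iff_agree {S : Set (GammaL p F)} :
    IsIntersecting (NonzeroVec F) S ↔ ∀ g ∈ S, ∀ h ∈ S, Agree g h :=
  forall₄_congr fun _ _ _ _ =>
    ⟨fun ⟨w, hw⟩ => ⟨w, w.2, congrArg Subtype.val hw⟩,
      fun ⟨v, hv, hgh⟩ => ⟨⟨v, hv⟩, Subtype.ext hgh⟩⟩

theorem agree_mul_mul_right_iff (x g h : GammaL p F) : Agree (g * x) (h * x) ↔ Agree g h := by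
  constructor
  · rintro ⟨v, hv, hgh⟩
    exact ⟨semilin x v, semilin_ne_zero x hv, by rwa [← semilin_mul, ← semilin_mul]⟩
  · rintro ⟨v, hv, hgh⟩
    refine ⟨semilin x⁻¹ v, semilin_ne_zero _ hv, ?_⟩
    rw [← semilin_mul, ← semilin_mul, mul_inv_cancel_right, mul_inv_cancel_right, hgh]

theorem agree_mul_mul_left_iff (x g h : GammaL p F) : Agree (x * g) (x * h) ↔ Agree g h := by
  refine exists_congr fun v => and_congr_right fun _ => ?_
  rw [semilin_mul, semilin_mul, (semilin_injective x).eq_iff]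

theorem agree_iff_det_sub_eq_zero {g h : GammaL p F} (hright : g.right = h.right) :
    Agree g h ↔ (g.left.val - h.left.val).det = 0 := by
  rw [← Matrix.exists_mulVec_eq_zero_iff]
  constructor
  · rintro ⟨v, hv, hgh⟩
    refine ⟨h.right • v, (smul_ne_zero_iff_ne _).mpr hv, ?_⟩
    rw [Matrix.sub_mulVec, sub_eq_zero]
    simpa only [semilin_eq_mulVec_smul, hright] using hgh
  · rintro ⟨v, hv, hgh⟩
    refine ⟨h.right⁻¹ • v, (smul_ne_zero_iff_ne _).mpr hv, ?_⟩
    rw [semilin_eq_mulVec_smul, semilin_eq_mulVec_smul, hright, smul_inv_smul]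
    rwa [Matrix.sub_mulVec, sub_eq_zero] at hgh

theorem exists_semilin_eq_det_smul_add {g : GammaL p F} {v : Fin 2 → F} (hv : v ≠ 0)
    (hgv : semilin g v = v) :
    ∃ w, det₂ v w = 1 ∧ ∃ z : F, semilin g w = g.left.det.val • w + z • v := by
  obtain ⟨u, hu⟩ := exists_det₂_ne_zero hv
  have hw : det₂ v ((det₂ v u)⁻¹ • u) = 1 := by rw [det₂_smul_right, inv_mul_cancel₀ hu]
  set w := (det₂ v u)⁻¹ • u
  refine ⟨w, hw, det₂ (semilin g w) w, ?_⟩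
  have hdet : det₂ v (semilin g w) = g.left.det := by
    nth_rw 1 [← hgv]
    rw [det₂_semilin, hw, smul_one, mul_one]
  have hcramer := det₂_smul_eq_sub v w (semilin g w)
  rwa [hw, one_smul, det₂_comm (semilin g w) v, hdet, neg_smul, sub_neg_eq_add, add_comm]
    at hcramer

-- The map `a ↦ d a - σ a` on the finite field is additive. If it is not injective, the twisted
-- element has a fixed vector on the line of `v`; if it is surjective, it has one off that line.
theorem agree_one_detTwist {g : GammaL p F} (h : Agree 1 g) : Agree 1 (detTwist g) := by
  obtain ⟨v, hv, hgv⟩ := h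
  rw [semilin_one] at hgv
  set d : Fˣ := g.left.det
  suffices ∃ w ≠ 0, semilin g w = d.val • w by
    obtain ⟨w, hw, hgw⟩ := this
    exact ⟨w, hw, by rw [semilin_one, semilin_detTwist, eq_inv_smul_iff, hgw]; rfl⟩
  let δ : F →+ F := AddMonoidHom.mulLeft d.val - DistribSMul.toAddMonoidHom F g.right
  have hδ (a : F) : δ a = d * a - g.right • a := rfl
  by_cases hinj : Function.Injective δ
  · obtain ⟨w, hw, z, hz⟩ := exists_semilin_eq_det_smul_add hv hgv.symm
    obtain ⟨a, rfl⟩ := Finite.surjective_of_injective hinj z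
    refine ⟨a • v + w, fun h0 => one_ne_zero (α := F) ?_, ?_⟩
    · rw [← hw, eq_neg_of_add_eq_zero_right h0, ← neg_smul, det₂_smul_right, det₂_self, mul_zero]
    · rw [semilin_add, semilin_smul, ← hgv, hz, hδ]
      module
  · obtain ⟨a, ha, ha0⟩ : ∃ a, δ a = 0 ∧ a ≠ 0 := by
      by_contra! hker
      exact hinj ((injective_iff_map_eq_zero δ).mpr hker)
    rw [hδ, sub_eq_zero] at ha
    exact ⟨a • v, smul_ne_zero ha0 hv, by rw [semilin_smul, ← hgv, smul_smul, ha]⟩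

theorem Agree.detTwist {g h : GammaL p F} (hgh : Agree g h) : Agree (detTwist g) (detTwist h) := by
  rw [← agree_mul_mul_left_iff (g⁻¹), inv_mul_cancel] at hgh
  rw [← agree_mul_mul_left_iff (SemilinearEKR.detTwist g)⁻¹, inv_mul_cancel, ← map_inv, ← map_mul]
  exact agree_one_detTwist hgh

/-! ### Intersecting sets with one field automorphism -/

/-- The elements with field automorphism `σ` that map `v` to `u`. Vertical sets are unions of
transporters, horizontal sets are unions of preimages of transporters under `detTwist`. -/
def transporter (σ : FrobGroup p F) (v u : Fin 2 → F) : Set (GammaL p F) :=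
  {g | g.right = σ ∧ semilin g v = u}

theorem transporter_units_smul (σ : FrobGroup p F) (b : Fˣ) (v u : Fin 2 → F) :
    transporter σ (b • v) u = transporter σ v ((σ • b)⁻¹ • u) := by
  ext g
  refine and_congr_right fun hg => ?_
  rw [semilin_units_smul, hg, eq_inv_smul_iff]

theorem mul_mem_transporter_iff {x g : GammaL p F} {σ τ : FrobGroup p F} (hx : x.right = τ)
    (v u : Fin 2 → F) : x * g ∈ transporter (τ * σ) v (semilin x u) ↔ g ∈ transporter σ v u := by
  refine and_congr ?_ ?_
  · rw [SemidirectProduct.mul_right, hx, mul_right_inj]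
  · rw [semilin_mul, (semilin_injective x).eq_iff]

theorem mul_mem_transporter {g h : GammaL p F} {σ τ : FrobGroup p F} {v u w : Fin 2 → F}
    (hg : g ∈ transporter σ u w) (hh : h ∈ transporter τ v u) : g * h ∈ transporter (σ * τ) v w :=
  hg.2 ▸ (mul_mem_transporter_iff hg.1 v u).mpr hh

theorem inv_mem_transporter {g : GammaL p F} {σ : FrobGroup p F} {v u : Fin 2 → F}
    (hg : g ∈ transporter σ v u) : g⁻¹ ∈ transporter σ⁻¹ u v :=
  ⟨by rw [SemidirectProduct.inv_right, hg.1], semilin_inv_eq_iff.mpr hg.2⟩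

theorem mem_transporter_one_e₁_iff {g : GammaL p F} {a : Fˣ} :
    g ∈ transporter 1 e₁ (a • e₁) ↔ ∃ (y : Fˣ) (z : F), g = ofGL p (upper a y z) := by
  constructor
  · rintro ⟨hright, hge⟩
    rw [semilin_eq_mulVec_smul, smul_e₁] at hge
    have h₀ : g.left.val 0 0 = a := by
      simpa [Matrix.mulVec, dotProduct, Units.smul_def] using congrFun hge 0
    have h₁ : g.left.val 1 0 = 0 := by
      simpa [Matrix.mulVec, dotProduct, Units.smul_def] using congrFun hge 1
    have hdet := g.left.det.ne_zero
    rw [Matrix.GeneralLinearGroup.val_det_apply, Matrix.det_fin_two, h₁, mul_zero, sub_zero] at hdet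
    refine ⟨Units.mk0 (g.left.val 1 1) (right_ne_zero_of_mul hdet), g.left.val 0 1,
      SemidirectProduct.ext (Units.ext ?_) hright⟩
    ext i j
    fin_cases i <;> fin_cases j <;> simp [ofGL, upper, h₀, h₁]
  · rintro ⟨y, z, rfl⟩
    refine ⟨rfl, ?_⟩
    ext i
    fin_cases i <;> simp [semilin, ofGL, upper, Units.smul_def]

theorem ncard_transporter_one_e₁ :
    (transporter (1 : FrobGroup p F) e₁ e₁).ncard = Nat.card F * (Nat.card F - 1) := by
  have hrange : transporter (1 : FrobGroup p F) e₁ e₁ =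
      Set.range fun yz : Fˣ × F => ofGL p (upper 1 yz.1 yz.2) := by
    ext g
    nth_rw 2 [← one_smul Fˣ (e₁ : Fin 2 → F)]
    rw [mem_transporter_one_e₁_iff]
    simp [eq_comm]
  have hinj : Function.Injective fun yz : Fˣ × F => ofGL p (upper 1 yz.1 yz.2) := by
    intro ⟨y, z⟩ ⟨y', z'⟩ h
    have h' := congrArg Units.val (SemidirectProduct.inl_injective h)
    have hz : z = z' := congrFun (congrFun h' 0) 1
    have hy : y = y' := Units.ext (congrFun (congrFun h' 1) 1)
    rw [hy, hz]
  rw [hrange, ← Nat.card_coe_set_eq, Nat.card_range_of_injective hinj, Nat.card_prod,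
    Nat.card_units, mul_comm]

theorem ncard_transporter (σ : FrobGroup p F) {v u : Fin 2 → F} (hv : v ≠ 0) (hu : u ≠ 0) :
    (transporter σ v u).ncard = Nat.card F * (Nat.card F - 1) := by
  obtain ⟨P, hP⟩ := exists_semilin (1 : FrobGroup p F) hv e₁_ne_zero
  obtain ⟨Q, hQ⟩ := exists_semilin σ e₁_ne_zero hu
  have himage : (fun h => Q * h * P) '' transporter 1 e₁ e₁ = transporter σ v u := by
    ext g
    constructor
    · rintro ⟨h, hh, rfl⟩
      simpa using mul_mem_transporter (mul_mem_transporter hQ hh) hP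
    · refine fun hg => ⟨Q⁻¹ * g * P⁻¹, ?_, by group⟩
      simpa using
        mul_mem_transporter (mul_mem_transporter (inv_mem_transporter hQ) hg)
          (inv_mem_transporter hP)
  rw [← himage, Set.ncard_image_of_injective _ fun _ _ h => by simpa using h,
    ncard_transporter_one_e₁]

theorem ncard_preimage_detTwist (S : Set (GammaL p F)) :
    (detTwist ⁻¹' S).ncard = S.ncard :=
  Set.ncard_preimage_of_injective_subset_range detTwist_involutive.injective fun g _ =>
    ⟨detTwist g, detTwist_involutive g⟩

theorem semilin_detTwist_inv_smul_adjugate (g : GammaL p F) (w : Fin 2 → F) :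
    semilin (detTwist g) (g.right⁻¹ • (g.left.val.adjugate *ᵥ w)) = w := by
  rw [semilin_detTwist, inv_smul_eq_iff, semilin_eq_mulVec_smul, smul_inv_smul,
    Matrix.mulVec_mulVec, Matrix.mul_adjugate, Matrix.smul_mulVec, Matrix.one_mulVec]
  rfl

theorem exists_subset_transporter {S : Set (GammaL p F)} {σ : FrobGroup p F}
    (hσ : ∀ g ∈ S, g.right = σ) (hS : ∀ g ∈ S, ∀ h ∈ S, Agree g h) :
    ∃ v u, v ≠ 0 ∧ u ≠ 0 ∧
      (S ⊆ transporter σ v u ∨ S ⊆ detTwist ⁻¹' transporter σ v u) := by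
  obtain rfl | ⟨g₀, hg₀⟩ := S.eq_empty_or_nonempty
  · exact ⟨e₁, e₁, e₁_ne_zero, e₁_ne_zero, .inl (Set.empty_subset _)⟩
  obtain ⟨v, hv, hker | hker⟩ :=
    exists_common_kernel (𝒩 := (fun g : GammaL p F => g.left.val - g₀.left.val) '' S)
      ⟨g₀, hg₀, sub_self _⟩ <| by
        rintro _ ⟨g, hg, rfl⟩ _ ⟨h, hh, rfl⟩
        rw [sub_sub_sub_cancel_right, ← agree_iff_det_sub_eq_zero ((hσ g hg).trans (hσ h hh).symm)]
        exact hS g hg h hh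
  · refine ⟨σ⁻¹ • v, semilin g₀ (σ⁻¹ • v), (smul_ne_zero_iff_ne _).mpr hv,
      semilin_ne_zero _ ((smul_ne_zero_iff_ne _).mpr hv), .inl fun g hg => ⟨hσ g hg, ?_⟩⟩
    have h := hker _ ⟨g, hg, rfl⟩
    rw [Matrix.sub_mulVec, sub_eq_zero] at h
    rw [semilin_eq_mulVec_smul, semilin_eq_mulVec_smul, hσ g hg, hσ g₀ hg₀, smul_inv_smul, h]
  · have hadj (g) (hg : g ∈ S) : g.left.val.adjugate *ᵥ v = g₀.left.val.adjugate *ᵥ v := by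
      have h := hker _ ⟨g, hg, rfl⟩
      rwa [adjugate_sub_fin_two, Matrix.sub_mulVec, sub_eq_zero] at h
    have htwist (g) (hg : g ∈ S) :
        semilin (detTwist g) (σ⁻¹ • (g₀.left.val.adjugate *ᵥ v)) = v := by
      rw [← hadj g hg, ← hσ g hg, semilin_detTwist_inv_smul_adjugate]
    refine ⟨_, v, fun h => hv ?_, hv, .inr fun g hg => ⟨hσ g hg, htwist g hg⟩⟩
    rw [← htwist g₀ hg₀, h, semilin_zero]

/-! ### The size of an intersecting set -/

/-- The elements of `S` with field automorphism `σ`. -/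
def fiber (S : Set (GammaL p F)) (σ : FrobGroup p F) : Set (GammaL p F) :=
  {g ∈ S | g.right = σ}

theorem ncard_eq_sum_ncard_fiber [Fintype (FrobGroup p F)] (S : Set (GammaL p F)) :
    S.ncard = ∑ σ, (fiber S σ).ncard := by
  classical
  have := Fintype.ofFinite (GammaL p F)
  rw [Set.ncard_eq_toFinset_card' S,
    Finset.card_eq_sum_card_fiberwise fun g _ => Finset.mem_univ g.right]
  refine Finset.sum_congr rfl fun σ _ => ?_
  rw [← Set.ncard_coe_finset]
  congr 1
  ext g
  simp [fiber]

theorem ncard_eq_card_mul_of_fiber {S : Set (GammaL p F)} {n : ℕ}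
    (h : ∀ σ, (fiber S σ).ncard = n) : S.ncard = Nat.card (FrobGroup p F) * n := by
  have := Fintype.ofFinite (FrobGroup p F)
  simp [ncard_eq_sum_ncard_fiber, h, Nat.card_eq_fintype_card]

variable (p F) in
/-- The size of a point stabilizer, and of the largest intersecting sets. -/
noncomputable def maxCard : ℕ :=
  Nat.card (FrobGroup p F) * (Nat.card F * (Nat.card F - 1))

theorem IsIntersecting.exists_fiber_subset {S : Set (GammaL p F)}
    (hS : IsIntersecting (NonzeroVec F) S) (σ : FrobGroup p F) :
    ∃ v u, v ≠ 0 ∧ u ≠ 0 ∧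
      (fiber S σ ⊆ transporter σ v u ∨ fiber S σ ⊆ detTwist ⁻¹' transporter σ v u) :=
  exists_subset_transporter (fun _ hg => hg.2) fun g hg h hh =>
    isIntersecting_iff_agree.mp hS g hg.1 h hh.1

theorem IsIntersecting.ncard_fiber_le {S : Set (GammaL p F)}
    (hS : IsIntersecting (NonzeroVec F) S) (σ : FrobGroup p F) :
    (fiber S σ).ncard ≤ Nat.card F * (Nat.card F - 1) := by
  obtain ⟨v, u, hv, hu, hsub | hsub⟩ := hS.exists_fiber_subset σ
  · exact (Set.ncard_le_ncard hsub).trans_eq (ncard_transporter σ hv hu)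
  · exact (Set.ncard_le_ncard hsub).trans_eq
      ((ncard_preimage_detTwist _).trans (ncard_transporter σ hv hu))

theorem IsIntersecting.ncard_le {S : Set (GammaL p F)} (hS : IsIntersecting (NonzeroVec F) S) :
    S.ncard ≤ maxCard p F := by
  have := Fintype.ofFinite (FrobGroup p F)
  rw [ncard_eq_sum_ncard_fiber, maxCard, Nat.card_eq_fintype_card, ← smul_eq_mul,
    ← Finset.card_univ]
  exact Finset.sum_le_card_nsmul _ _ _ fun σ _ => hS.ncard_fiber_le σ

theorem fiber_stabilizer (w : NonzeroVec F) (σ : FrobGroup p F) :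
    fiber (MulAction.stabilizer (GammaL p F) w : Set (GammaL p F)) σ = transporter σ w w := by
  ext g
  exact and_comm.trans (and_congr_right fun _ => Subtype.ext_iff)

theorem card_stabilizer (w : NonzeroVec F) :
    Nat.card (MulAction.stabilizer (GammaL p F) w) = maxCard p F := by
  rw [← SetLike.coe_sort_coe, Nat.card_coe_set_eq]
  exact ncard_eq_card_mul_of_fiber fun σ => by
    rw [fiber_stabilizer, ncard_transporter σ w.2 w.2]

theorem isIntersecting_stabilizer (w : NonzeroVec F) :
    IsIntersecting (NonzeroVec F) (MulAction.stabilizer (GammaL p F) w : Set (GammaL p F)) :=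
  fun _ hg _ hh => ⟨w, hg.trans hh.symm⟩

theorem hasEKR_GammaL : HasEKR (GammaL p F) (NonzeroVec F) := fun _ hS w =>
  (card_stabilizer (p := p) w).symm ▸ hS.ncard_le

theorem isGreatest_maxCard :
    IsGreatest {n | ∃ S : Set (GammaL p F), IsIntersecting (NonzeroVec F) S ∧ S.ncard = n}
      (maxCard p F) := by
  refine ⟨⟨_, isIntersecting_stabilizer ⟨e₁, e₁_ne_zero⟩, card_stabilizer _⟩, ?_⟩
  rintro _ ⟨S, hS, rfl⟩
  exact hS.ncard_le

theorem isMaximumIntersecting_iff_ncard {S : Set (GammaL p F)} :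
    IsMaximumIntersecting (NonzeroVec F) S ↔
      IsIntersecting (NonzeroVec F) S ∧ S.ncard = maxCard p F := by
  refine and_congr_right fun hS => ⟨fun hmax => hS.ncard_le.antisymm ?_, fun h T hT => ?_⟩
  · obtain ⟨T, hT, hcard⟩ := (isGreatest_maxCard (p := p) (F := F)).1
    exact hcard ▸ hmax T hT
  · exact h ▸ hT.ncard_le

theorem IsMaximumIntersecting.exists_fiber_eq {S : Set (GammaL p F)}
    (hS : IsMaximumIntersecting (NonzeroVec F) S) (σ : FrobGroup p F) :
    ∃ v u, v ≠ 0 ∧ u ≠ 0 ∧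
      (fiber S σ = transporter σ v u ∨ fiber S σ = detTwist ⁻¹' transporter σ v u) := by
  obtain ⟨hint, hcard⟩ := isMaximumIntersecting_iff_ncard.mp hS
  have hfull : (fiber S σ).ncard = Nat.card F * (Nat.card F - 1) := by
    have := Fintype.ofFinite (FrobGroup p F)
    refine (Finset.sum_eq_sum_iff_of_le fun τ _ => hint.ncard_fiber_le τ).mp ?_ σ
      (Finset.mem_univ σ)
    rw [← ncard_eq_sum_ncard_fiber, hcard, maxCard]
    simp [Nat.card_eq_fintype_card]
  obtain ⟨v, u, hv, hu, hsub | hsub⟩ := hint.exists_fiber_subset σ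
  · refine ⟨v, u, hv, hu, .inl (Set.eq_of_subset_of_ncard_le hsub ?_)⟩
    rw [ncard_transporter σ hv hu, hfull]
  · refine ⟨v, u, hv, hu, .inr (Set.eq_of_subset_of_ncard_le hsub ?_)⟩
    rw [ncard_preimage_detTwist, ncard_transporter σ hv hu, hfull]

theorem preimage_detTwist_preimage (S : Set (GammaL p F)) :
    detTwist ⁻¹' (detTwist ⁻¹' S) = S := by
  rw [← Set.preimage_comp, detTwist_involutive.comp_self, Set.preimage_id]

theorem IsIntersecting.preimage_detTwist {S : Set (GammaL p F)}
    (hS : IsIntersecting (NonzeroVec F) S) :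
    IsIntersecting (NonzeroVec F) (detTwist ⁻¹' S) :=
  isIntersecting_iff_agree.mpr fun g hg h hh => by
    simpa only [detTwist_involutive _] using
      (isIntersecting_iff_agree.mp hS _ hg _ hh).detTwist

theorem IsMaximumIntersecting.preimage_detTwist {S : Set (GammaL p F)}
    (hS : IsMaximumIntersecting (NonzeroVec F) S) :
    IsMaximumIntersecting (NonzeroVec F) (detTwist ⁻¹' S) := by
  rw [isMaximumIntersecting_iff_ncard] at hS ⊢
  rw [ncard_preimage_detTwist]
  exact hS.imp_left IsIntersecting.preimage_detTwist

theorem isMaximumIntersecting_preimage_detTwist_iff {S : Set (GammaL p F)} :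
    IsMaximumIntersecting (NonzeroVec F) (detTwist ⁻¹' S) ↔
      IsMaximumIntersecting (NonzeroVec F) S :=
  ⟨fun h => preimage_detTwist_preimage S ▸ h.preimage_detTwist,
    IsMaximumIntersecting.preimage_detTwist⟩

theorem fiber_preimage_detTwist (S : Set (GammaL p F)) (σ : FrobGroup p F) :
    fiber (detTwist ⁻¹' S) σ = detTwist ⁻¹' fiber S σ := rfl

/-! ### The group of field automorphisms -/

theorem pos_of_card_eq_pow {F : Type*} [Field F] [Finite F] {p k : ℕ}
    (hF : Nat.card F = p ^ k) : 0 < k := by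
  refine Nat.pos_of_ne_zero fun hk => (Finite.one_lt_card (α := F)).ne' ?_
  rw [hF, hk, pow_zero]

variable (p F) in
/-- The Frobenius automorphism as the generator of `FrobGroup p F`. -/
noncomputable def frobGen : FrobGroup p F := ⟨frob p F, Subgroup.mem_zpowers _⟩

theorem frobGen_pow_smul (n : ℕ) (x : F) : frobGen p F ^ n • x = x ^ p ^ n := by
  change (frob p F ^ n) x = _
  rw [← iterateFrobeniusEquiv_eq_pow, iterateFrobeniusEquiv_def]

theorem frobGen_pow_smul_units (n : ℕ) (x : Fˣ) : frobGen p F ^ n • x = x ^ p ^ n :=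
  Units.ext (frobGen_pow_smul n x.val)

theorem orderOf_frobGen {k : ℕ} (hF : Nat.card F = p ^ k) : orderOf (frobGen p F) = k := by
  have hp : 1 < p := (Fact.out : p.Prime).one_lt
  refine (orderOf_eq_iff (pos_of_card_eq_pow hF)).mpr ⟨?_, fun m hmk hm hone => ?_⟩
  · have := Fintype.ofFinite F
    ext x
    change frobGen p F ^ k • x = x
    rw [frobGen_pow_smul, ← hF, Nat.card_eq_fintype_card, FiniteField.pow_card]
  · obtain ⟨u, hu⟩ := IsCyclic.exists_generator (α := Fˣ)
    have horder : orderOf u = p ^ k - 1 := by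
      rw [orderOf_eq_card_of_forall_mem_zpowers hu, Nat.card_units, hF]
    have hfix : u ^ (p ^ m) = u := by rw [← frobGen_pow_smul_units, hone, one_smul]
    have hpow : u ^ (p ^ m - 1) = 1 := by
      rw [← mul_eq_right (b := u), ← pow_succ, Nat.sub_add_cancel (Nat.one_le_pow _ _ hp.le), hfix]
    have hle := Nat.le_of_dvd (Nat.sub_pos_of_lt (Nat.one_lt_pow hm.ne' hp))
      (horder ▸ orderOf_dvd_of_pow_eq_one hpow)
    have hlt : p ^ m < p ^ k := Nat.pow_lt_pow_right hp hmk
    have hpos : 1 ≤ p ^ m := Nat.one_le_pow _ _ hp.le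
    omega

theorem mem_zpowers_frobGen (σ : FrobGroup p F) : σ ∈ Subgroup.zpowers (frobGen p F) := by
  obtain ⟨_, n, rfl⟩ := σ
  exact ⟨n, Subtype.ext rfl⟩

theorem card_frobGroup {k : ℕ} (hF : Nat.card F = p ^ k) : Nat.card (FrobGroup p F) = k := by
  rw [← orderOf_eq_card_of_forall_mem_zpowers mem_zpowers_frobGen, orderOf_frobGen hF]

theorem exists_frobGen_pow_eq {k : ℕ} (hF : Nat.card F = p ^ k) (σ : FrobGroup p F) :
    ∃ j < k, frobGen p F ^ j = σ := by
  obtain ⟨n, rfl⟩ := (isOfFinOrder_of_finite _).mem_powers_iff_mem_zpowers.mpr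
    (mem_zpowers_frobGen σ)
  refine ⟨n % k, Nat.mod_lt _ (pos_of_card_eq_pow hF), ?_⟩
  rw [← orderOf_frobGen hF, pow_mod_orderOf]

theorem frobGen_pow_inj {k : ℕ} (hF : Nat.card F = p ^ k) {i j : ℕ} (hi : i < k) (hj : j < k) :
    frobGen p F ^ i = frobGen p F ^ j ↔ i = j := by
  rw [pow_inj_mod, orderOf_frobGen hF, Nat.mod_eq_of_lt hi, Nat.mod_eq_of_lt hj]

/-- The fixed field of `ρ` has more than two elements. This is what makes some scalar multiple of
`ρ` a derangement of the non-zero vectors. -/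
def HasFixedUnit (ρ : FrobGroup p F) : Prop :=
  ∃ x : Fˣ, x ≠ 1 ∧ ρ • x = x

theorem HasFixedUnit.zpow {ρ : FrobGroup p F} (h : HasFixedUnit ρ) (n : ℤ) :
    HasFixedUnit (ρ ^ n) := by
  obtain ⟨x, hx, hρ⟩ := h
  exact ⟨x, hx, zpow_mem (show ρ ∈ MulAction.stabilizer (FrobGroup p F) x from hρ) n⟩

-- The homomorphism `y ↦ y / ρ y` is not injective, hence not surjective.
theorem HasFixedUnit.exists_mul_smul_ne {ρ : FrobGroup p F} (h : HasFixedUnit ρ) :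
    ∃ c : Fˣ, ∀ y : Fˣ, c * ρ • y ≠ y := by
  obtain ⟨x, hx, hρ⟩ := h
  have hnotinj : ¬ Function.Injective fun y : Fˣ => y / ρ • y := fun hinj =>
    hx (hinj (by simp only [hρ, smul_one, div_self']))
  rw [Finite.injective_iff_surjective, Function.Surjective] at hnotinj
  push Not at hnotinj
  exact hnotinj.imp fun c hc y hy => hc y (div_eq_of_eq_mul' (by rw [mul_comm, hy]))

theorem hasFixedUnit_of_ne_two (hp : p ≠ 2) (ρ : FrobGroup p F) : HasFixedUnit ρ := by
  refine ⟨-1, fun h => Ring.neg_one_ne_one_of_char_ne_two (R := F) ?_ (Units.ext_iff.mp h), ?_⟩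
  · rwa [ringChar.eq F p]
  · exact Units.ext (by simp)

theorem hasFixedUnit_frobGen_pow {k d : ℕ} (hF : Nat.card F = p ^ k) (hd : 1 < d) (hdk : d ∣ k) :
    HasFixedUnit (frobGen p F ^ d) := by
  have hp : 1 < p := (Fact.out : p.Prime).one_lt
  obtain ⟨u, hu⟩ := IsCyclic.exists_ofOrder_eq_natCard (α := Fˣ)
  have hpos : 1 < p ^ d - 1 := by
    have : 2 ^ 2 ≤ p ^ d := (Nat.pow_le_pow_left hp 2).trans (Nat.pow_le_pow_right hp.le hd)
    omega
  obtain ⟨m, hm⟩ : p ^ d - 1 ∣ orderOf u := by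
    rw [hu, Nat.card_units, hF]
    exact Nat.pow_sub_one_dvd_pow_sub_one p hdk
  have horder : orderOf (u ^ m) = p ^ d - 1 := by
    have hm0 : 0 < m := Nat.pos_of_ne_zero fun h => (orderOf_pos u).ne' (by rw [hm, h, mul_zero])
    rw [orderOf_pow_of_dvd hm0.ne' (hm ▸ dvd_mul_left _ _), hm, Nat.mul_div_cancel _ hm0]
  refine ⟨u ^ m, fun h => hpos.ne' ?_, ?_⟩
  · rw [← horder, h, orderOf_one]
  · rw [frobGen_pow_smul_units, ← Nat.sub_add_cancel (Nat.one_le_pow d p hp.le), pow_succ,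
      ← horder, pow_orderOf_eq_one, one_mul]

-- For `p = 2`, Bézout writes the exponent of `σ` as a combination of two distinct primes `a`
-- and `b` dividing `k`, and the powers of `φ ^ a` fix the subfield of order `2 ^ a`.
theorem exists_mul_eq_hasFixedUnit {k : ℕ} (hk : p = 2 → ¬ IsPrimePow k) (hF : Nat.card F = p ^ k)
    (σ : FrobGroup p F) :
    ∃ ρ₁ ρ₂, ρ₁ * ρ₂ = σ ∧ (ρ₁ = 1 ∨ HasFixedUnit ρ₁) ∧ (ρ₂ = 1 ∨ HasFixedUnit ρ₂) := by
  by_cases hp : p = 2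
  swap
  · exact ⟨σ, 1, mul_one σ, .inr (hasFixedUnit_of_ne_two hp σ), .inl rfl⟩
  by_cases hk1 : k = 1
  · obtain ⟨j, hj, rfl⟩ := exists_frobGen_pow_eq hF σ
    rw [hk1, Nat.lt_one_iff] at hj
    exact ⟨1, 1, by rw [hj, pow_zero, mul_one], .inl rfl, .inl rfl⟩
  have ha : k.minFac.Prime := Nat.minFac_prime hk1
  obtain ⟨b, hb, hbk, hne⟩ : ∃ b : ℕ, b.Prime ∧ b ∣ k ∧ b ≠ k.minFac := by
    by_contra! h
    exact hk hp (isPrimePow_iff_unique_prime_dvd.mpr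
      ⟨k.minFac, ⟨ha, Nat.minFac_dvd k⟩, fun r hr => h r hr.1 hr.2⟩)
  obtain ⟨s, t, hst⟩ := Nat.isCoprime_iff_coprime.mpr ((Nat.coprime_primes hb ha).mpr hne)
  obtain ⟨n, rfl⟩ := mem_zpowers_frobGen σ
  refine ⟨(frobGen p F ^ b) ^ (s * n), (frobGen p F ^ k.minFac) ^ (t * n), ?_,
    .inr ((hasFixedUnit_frobGen_pow hF hb.one_lt hbk).zpow _),
    .inr ((hasFixedUnit_frobGen_pow hF ha.one_lt (Nat.minFac_dvd k)).zpow _)⟩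
  rw [← zpow_natCast, ← zpow_natCast, ← zpow_mul, ← zpow_mul, ← zpow_add]
  exact congrArg _ (by linear_combination n * hst)

/-! ### Fibers that agree with each other -/

section ScalarAut

open Matrix.GeneralLinearGroup (scalar)

/-- The semilinear map `v ↦ c • v^ρ`. -/
def scalarAut (c : Fˣ) (ρ : FrobGroup p F) : GammaL p F := ⟨scalar (Fin 2) c, ρ⟩

theorem semilin_scalarAut (c : Fˣ) (ρ : FrobGroup p F) (v : Fin 2 → F) :
    semilin (scalarAut c ρ) v = c • ρ • v := by
  change Matrix.scalar (Fin 2) c.val *ᵥ (ρ • v) = c • ρ • v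
  rw [Matrix.scalar_apply, ← Matrix.smul_one_eq_diagonal, Matrix.smul_mulVec, Matrix.one_mulVec]
  rfl

theorem detTwist_scalarAut (c : Fˣ) (ρ : FrobGroup p F) :
    detTwist (scalarAut c ρ) = scalarAut c⁻¹ ρ := by
  have hdet : (scalarAut c ρ).left.det = c ^ 2 := Matrix.GeneralLinearGroup.det_scalar c
  refine semilin_ext rfl fun v => ?_
  rw [semilin_detTwist, hdet, semilin_scalarAut, semilin_scalarAut, smul_smul]
  congr 1
  group

theorem not_agree_one_scalarAut {c : Fˣ} {ρ : FrobGroup p F} (hc : ∀ y : Fˣ, c * ρ • y ≠ y) :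
    ¬ Agree 1 (scalarAut c ρ) := by
  rintro ⟨v, hv, h⟩
  rw [semilin_one, semilin_scalarAut] at h
  obtain ⟨i, hi⟩ := Function.ne_iff.mp hv
  exact hc (Units.mk0 (v i) hi) (Units.ext (congrFun h i).symm)

theorem not_agree_mul_scalarAut_mul {c : Fˣ} {ρ : FrobGroup p F} (hc : ∀ y : Fˣ, c * ρ • y ≠ y)
    (X P : GammaL p F) : ¬ Agree (X * P⁻¹) (X * scalarAut c ρ * P⁻¹) := by
  rw [agree_mul_mul_right_iff]
  nth_rw 1 [← mul_one X]
  rw [agree_mul_mul_left_iff]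
  exact not_agree_one_scalarAut hc

end ScalarAut

/-- Every element of `S` agrees with every element of `T`. -/
def CrossAgree (S T : Set (GammaL p F)) : Prop :=
  ∀ g ∈ S, ∀ h ∈ T, Agree g h

theorem exists_det₂_smul_self_ne_zero {ρ : FrobGroup p F} (hρ : ρ ≠ 1) :
    ∃ y : Fin 2 → F, det₂ y (ρ • y) ≠ 0 := by
  obtain ⟨a, ha⟩ : ∃ a : F, ρ • a ≠ a := by
    by_contra! h
    exact hρ (Subtype.ext (RingEquiv.ext h))
  refine ⟨![1, a], ?_⟩
  simpa [det₂, sub_eq_zero] using ha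

theorem exists_det₂_eq_and_det₂_smul_eq {ρ : FrobGroup p F} (hρ : ρ ≠ 1) (b d : F) :
    ∃ x y : Fin 2 → F, x ≠ 0 ∧ y ≠ 0 ∧ det₂ x y = b ∧ det₂ x (ρ • y) = d := by
  by_cases h0 : b = 0 ∧ d = 0
  · obtain ⟨rfl, rfl⟩ := h0
    exact ⟨e₁, e₁, e₁_ne_zero, e₁_ne_zero, det₂_self _, by rw [smul_e₁, det₂_self]⟩
  obtain ⟨y, hy⟩ := exists_det₂_smul_self_ne_zero hρ
  set m := det₂ y (ρ • y) with hm
  have hb : det₂ ((d / m) • y - (b / m) • ρ • y) y = b := by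
    simp only [det₂, Pi.sub_apply, Pi.smul_apply, smul_eq_mul] at hm ⊢
    field_simp
    linear_combination (-b) * hm
  have hd : det₂ ((d / m) • y - (b / m) • ρ • y) (ρ • y) = d := by
    simp only [det₂, Pi.sub_apply, Pi.smul_apply, smul_eq_mul] at hm ⊢
    field_simp
    linear_combination (-d) * hm
  refine ⟨_, y, fun hx => h0 ?_, fun h => hy ?_, hb, hd⟩
  · rw [hx] at hb hd
    simp only [det₂, Pi.zero_apply, zero_mul, sub_zero] at hb hd
    exact ⟨hb.symm, hd.symm⟩
  · rw [hm, h, smul_zero, det₂_self]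

theorem not_crossAgree_transporter_of_semilin {ρ σ : FrobGroup p F} {c : Fˣ}
    (hc : ∀ y : Fˣ, c * ρ • y ≠ y) {P X : GammaL p F} (hP : P.right = 1) (hX : X.right = σ)
    (x y : Fin 2 → F) :
    ¬ CrossAgree (transporter σ (semilin P x) (semilin X x))
      (transporter (σ * ρ) (semilin P y) (semilin X (c • ρ • y))) := by
  refine fun h => not_agree_mul_scalarAut_mul hc X P (h _ ⟨?_, ?_⟩ _ ⟨?_, ?_⟩)
  · simp [hP, hX]
  · rw [← semilin_mul, inv_mul_cancel_right]
  · simp [hP, hX, scalarAut]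
  · rw [← semilin_mul, inv_mul_cancel_right, semilin_mul, semilin_scalarAut]

theorem not_crossAgree_transporter_detTwist_of_semilin {ρ σ : FrobGroup p F} {c : Fˣ}
    (hc : ∀ y : Fˣ, c * ρ • y ≠ y) {P X : GammaL p F} (hP : P.right = 1) (hX : X.right = σ)
    (x y : Fin 2 → F) :
    ¬ CrossAgree (transporter σ (semilin P x) (semilin X x))
      (detTwist ⁻¹' transporter (σ * ρ) (semilin (detTwist P) y)
        (semilin (detTwist X) (c⁻¹ • ρ • y))) := by
  refine fun h => not_agree_mul_scalarAut_mul hc X P (h _ ⟨?_, ?_⟩ _ ⟨?_, ?_⟩)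
  · simp [hP, hX]
  · rw [← semilin_mul, inv_mul_cancel_right]
  · simp [detTwist_right, hP, hX, scalarAut]
  · rw [← semilin_mul, map_mul, map_inv, inv_mul_cancel_right, map_mul, semilin_mul,
      detTwist_scalarAut, semilin_scalarAut]

theorem exists_semilin_det_eq (σ : FrobGroup p F) {x u : Fin 2 → F} (hx : x ≠ 0) (hu : u ≠ 0)
    (t : Fˣ) : ∃ g : GammaL p F, g.right = σ ∧ semilin g x = u ∧ g.left.det = t := by
  obtain ⟨x', hx'⟩ := exists_det₂_ne_zero hx
  obtain ⟨u', hu'⟩ := exists_det₂_ne_zero hu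
  have hσx' : σ • det₂ x x' ≠ 0 := (smul_ne_zero_iff_ne _).mpr hx'
  have huu' : det₂ u ((t * σ • det₂ x x' / det₂ u u') • u') = t * σ • det₂ x x' := by
    rw [det₂_smul_right, div_mul_cancel₀ _ hu']
  obtain ⟨g, hg, hgx, hgx'⟩ := exists_semilin_pair σ hx' (huu' ▸ mul_ne_zero t.ne_zero hσx')
  refine ⟨g, hg, hgx, Units.ext (mul_right_cancel₀ hσx' ?_)⟩
  rw [← huu', ← hgx', ← hgx, det₂_semilin, hg]

theorem exists_semilin_detTwist_pair {σ : FrobGroup p F} {x y u w : Fin 2 → F} (hx : x ≠ 0)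
    (hy : y ≠ 0) (hu : u ≠ 0) (hw : w ≠ 0) (hdet : σ • det₂ x y = det₂ u w) :
    ∃ g : GammaL p F, g.right = σ ∧ semilin g x = u ∧ semilin (detTwist g) y = w := by
  by_cases hxy : det₂ x y = 0
  · obtain ⟨b, rfl⟩ := exists_eq_units_smul_of_det₂_eq_zero hx hy hxy
    obtain ⟨d, rfl⟩ := exists_eq_units_smul_of_det₂_eq_zero hu hw (by rw [← hdet, hxy, smul_zero])
    obtain ⟨g, hg, hgx, hdet⟩ := exists_semilin_det_eq σ hx hu (σ • b / d)
    refine ⟨g, hg, hgx, ?_⟩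
    rw [semilin_detTwist, semilin_units_smul, hgx, hdet, hg, smul_smul, inv_div, div_mul_cancel]
  · have huw : det₂ u w ≠ 0 := by rwa [← hdet, smul_ne_zero_iff_ne]
    obtain ⟨g, hg, hgx, hgy⟩ := exists_semilin_pair σ hxy huw
    refine ⟨g, hg, hgx, ?_⟩
    have hone : g.left.det = 1 := by
      have h := det₂_semilin g x y
      rw [hgx, hgy, hg, hdet] at h
      exact Units.val_eq_one.mp ((right_eq_mul₀ huw).mp h)
    rw [semilin_detTwist, hone, inv_one, one_smul, hgy]

theorem not_crossAgree_transporter_of_pair {ρ σ : FrobGroup p F} {c : Fˣ}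
    (hc : ∀ y : Fˣ, c * ρ • y ≠ y) {x y v v' u u' : Fin 2 → F}
    (hP : ∃ P : GammaL p F, P.right = 1 ∧ semilin P x = v ∧ semilin P y = v')
    (hX : ∃ X : GammaL p F, X.right = σ ∧ semilin X x = u ∧ semilin X (c • ρ • y) = u') :
    ¬ CrossAgree (transporter σ v u) (transporter (σ * ρ) v' u') := by
  obtain ⟨P, hP, rfl, rfl⟩ := hP
  obtain ⟨X, hX, rfl, rfl⟩ := hX
  exact not_crossAgree_transporter_of_semilin hc hP hX x y

theorem det₂_eq_zero_of_crossAgree_transporter {ρ σ : FrobGroup p F} (hρ : ρ ≠ 1) {c : Fˣ}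
    (hc : ∀ y : Fˣ, c * ρ • y ≠ y) {v v' u u' : Fin 2 → F} (hv : v ≠ 0) (hu : u ≠ 0)
    (hv' : v' ≠ 0) (hu' : u' ≠ 0)
    (h : CrossAgree (transporter σ v u) (transporter (σ * ρ) v' u')) :
    det₂ v v' = 0 ∧ det₂ u u' = 0 := by
  obtain ⟨y, hy⟩ := exists_det₂_smul_self_ne_zero hρ
  have hy0 : y ≠ 0 := by
    rintro rfl
    exact hy (by rw [smul_zero, det₂_self])
  have hcy : c • ρ • y ≠ 0 := (smul_ne_zero_iff_ne _).mpr ((smul_ne_zero_iff_ne _).mpr hy0)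
  have hdet : det₂ y (c • ρ • y) ≠ 0 := by
    rw [Units.smul_def, det₂_smul_right]
    exact mul_ne_zero c.ne_zero hy
  by_contra hne
  by_cases hvv : det₂ v v' = 0
  · have huu : det₂ u u' ≠ 0 := fun huu => hne ⟨hvv, huu⟩
    obtain ⟨b, rfl⟩ := exists_eq_units_smul_of_det₂_eq_zero hv' hv
      (by rw [det₂_comm, hvv, neg_zero])
    obtain ⟨P, hP, hPy⟩ := exists_semilin (1 : FrobGroup p F) hy0 hv'
    refine not_crossAgree_transporter_of_pair (x := b • y) (y := y) hc ⟨P, hP, ?_, hPy⟩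
      (exists_semilin_pair σ ?_ huu) h
    · rw [semilin_units_smul, hP, one_smul, hPy]
    · rw [Units.smul_def, det₂_smul_left]
      exact mul_ne_zero b.ne_zero hdet
  by_cases huu : det₂ u u' = 0
  · obtain ⟨b, rfl⟩ := exists_eq_units_smul_of_det₂_eq_zero hu' hu
      (by rw [det₂_comm, huu, neg_zero])
    obtain ⟨X, hX, hXy⟩ := exists_semilin σ hcy hu'
    refine not_crossAgree_transporter_of_pair (x := (σ⁻¹ • b) • c • ρ • y) (y := y) hc
      (exists_semilin_pair 1 ?_ hvv) ⟨X, hX, ?_, hXy⟩ h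
    · rw [Units.smul_def, det₂_smul_left, det₂_comm]
      exact mul_ne_zero (σ⁻¹ • b).ne_zero (neg_ne_zero.mpr hdet)
    · rw [semilin_units_smul, hX, smul_inv_smul, hXy]
  · obtain ⟨x, z, -, -, hxz, hxρz⟩ := exists_det₂_eq_and_det₂_smul_eq hρ 1 1
    refine not_crossAgree_transporter_of_pair (x := x) (y := z) hc
      (exists_semilin_pair 1 ?_ hvv) (exists_semilin_pair σ ?_ huu) h
    · rw [hxz]
      exact one_ne_zero
    · rw [Units.smul_def, det₂_smul_right, hxρz, mul_one]
      exact c.ne_zero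

theorem not_crossAgree_transporter_detTwist {ρ σ : FrobGroup p F} (hρ : ρ ≠ 1) {c : Fˣ}
    (hc : ∀ y : Fˣ, c * ρ • y ≠ y) {v v' u u' : Fin 2 → F} (hv : v ≠ 0) (hu : u ≠ 0)
    (hv' : v' ≠ 0) (hu' : u' ≠ 0) :
    ¬ CrossAgree (transporter σ v u) (detTwist ⁻¹' transporter (σ * ρ) v' u') := by
  obtain ⟨x, y, hx, hy, hxy, hxρy⟩ :=
    exists_det₂_eq_and_det₂_smul_eq hρ (det₂ v v') (c.val * σ⁻¹ • det₂ u u')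
  have hcy : c⁻¹ • ρ • y ≠ 0 := (smul_ne_zero_iff_ne _).mpr ((smul_ne_zero_iff_ne _).mpr hy)
  obtain ⟨P, hP, rfl, rfl⟩ :=
    exists_semilin_detTwist_pair (σ := 1) hx hy hv hv' (by rw [one_smul, hxy])
  obtain ⟨X, hX, rfl, rfl⟩ := exists_semilin_detTwist_pair (σ := σ) hx hcy hu hu' <| by
    rw [Units.smul_def, det₂_smul_right, hxρy, Units.inv_mul_cancel_left, smul_inv_smul]
  exact not_crossAgree_transporter_detTwist_of_semilin hc hP hX x y

/-! ### The invariant line of a maximum intersecting set -/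

/-- The elements of `S` with field automorphism `σ` are all those that map `v` to one given
non-zero multiple of `v`. -/
def FixesLine (v : Fin 2 → F) (S : Set (GammaL p F)) (σ : FrobGroup p F) : Prop :=
  ∃ a : Fˣ, fiber S σ = transporter σ v (a • v)

theorem fixesLine_one {S : Set (GammaL p F)} (hone : 1 ∈ S) {v u : Fin 2 → F}
    (hfiber : fiber S 1 = transporter 1 v u) : FixesLine v S 1 := by
  have hmem : 1 ∈ transporter 1 v u := hfiber ▸ ⟨hone, rfl⟩
  refine ⟨1, ?_⟩
  rw [hfiber, one_smul, ← hmem.2, semilin_one]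

theorem FixesLine.of_units_smul {v : Fin 2 → F} {b : Fˣ} {S : Set (GammaL p F)}
    {σ : FrobGroup p F} (h : FixesLine (b • v) S σ) : FixesLine v S σ := by
  obtain ⟨a, ha⟩ := h
  exact ⟨(σ • b)⁻¹ * (a * b), by rw [ha, transporter_units_smul, smul_smul, smul_smul, mul_assoc]⟩

theorem FixesLine.exists_semilin_eq {v : Fin 2 → F} {S : Set (GammaL p F)}
    (h : ∀ σ, FixesLine v S σ) {g : GammaL p F} (hg : g ∈ S) :
    ∃ a : Fˣ, semilin g v = a • v := by
  obtain ⟨a, ha⟩ := h g.right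
  have hmem : g ∈ fiber S g.right := ⟨hg, rfl⟩
  rw [ha] at hmem
  exact ⟨a, hmem.2⟩

theorem IsIntersecting.crossAgree_fiber {S : Set (GammaL p F)}
    (hS : IsIntersecting (NonzeroVec F) S) (σ τ : FrobGroup p F) :
    CrossAgree (fiber S σ) (fiber S τ) := fun g hg h hh =>
  isIntersecting_iff_agree.mp hS g hg.1 h hh.1

theorem IsMaximumIntersecting.fixesLine_mul {S : Set (GammaL p F)}
    (hS : IsMaximumIntersecting (NonzeroVec F) S) {v : Fin 2 → F} (hv : v ≠ 0)
    {σ ρ : FrobGroup p F} (hσ : FixesLine v S σ) (hρ : ρ = 1 ∨ HasFixedUnit ρ) :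
    FixesLine v S (σ * ρ) := by
  obtain rfl | hone := eq_or_ne ρ 1
  · rwa [mul_one]
  obtain ⟨c, hc⟩ := (hρ.resolve_left hone).exists_mul_smul_ne
  obtain ⟨a, ha⟩ := hσ
  have hav : a • v ≠ 0 := (smul_ne_zero_iff_ne a).mpr hv
  have hcross := hS.1.crossAgree_fiber σ (σ * ρ)
  obtain ⟨v', u', hv', hu', hfiber | hfiber⟩ := hS.exists_fiber_eq (σ * ρ)
  · rw [ha, hfiber] at hcross
    obtain ⟨hvv', huu'⟩ :=
      det₂_eq_zero_of_crossAgree_transporter hone hc hv hav hv' hu' hcross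
    obtain ⟨b, rfl⟩ := exists_eq_units_smul_of_det₂_eq_zero hv hv' hvv'
    obtain ⟨d, rfl⟩ := exists_eq_units_smul_of_det₂_eq_zero hav hu' huu'
    refine ⟨((σ * ρ) • b)⁻¹ * (d * a), ?_⟩
    rw [hfiber, transporter_units_smul, smul_smul, smul_smul, mul_assoc]
  · rw [ha, hfiber] at hcross
    exact absurd hcross (not_crossAgree_transporter_detTwist hone hc hv hav hv' hu')

theorem IsMaximumIntersecting.fixesLine {k : ℕ} (hk : p = 2 → ¬ IsPrimePow k)
    (hF : Nat.card F = p ^ k) {S : Set (GammaL p F)}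
    (hS : IsMaximumIntersecting (NonzeroVec F) S) {v : Fin 2 → F} (hv : v ≠ 0)
    (h : FixesLine v S 1) (σ : FrobGroup p F) : FixesLine v S σ := by
  obtain ⟨ρ₁, ρ₂, rfl, hρ₁, hρ₂⟩ := exists_mul_eq_hasFixedUnit hk hF σ
  rw [← one_mul ρ₁]
  exact hS.fixesLine_mul hv (hS.fixesLine_mul hv h hρ₁) hρ₂

theorem IsMaximumIntersecting.exists_forall_fixesLine {k : ℕ} (hk : p = 2 → ¬ IsPrimePow k)
    (hF : Nat.card F = p ^ k) {S : Set (GammaL p F)}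
    (hS : IsMaximumIntersecting (NonzeroVec F) S) (hone : 1 ∈ S) :
    ∃ v ≠ 0, (∀ σ, FixesLine v S σ) ∨ ∀ σ, FixesLine v (detTwist ⁻¹' S) σ := by
  obtain ⟨v, u, hv, -, hfiber | hfiber⟩ := hS.exists_fiber_eq 1
  · exact ⟨v, hv, .inl (hS.fixesLine hk hF hv (fixesLine_one hone hfiber))⟩
  · refine ⟨v, hv, .inr (hS.preimage_detTwist.fixesLine hk hF hv
      (fixesLine_one (u := u) (by rwa [Set.mem_preimage, map_one]) ?_))⟩
    rw [fiber_preimage_detTwist, hfiber, preimage_detTwist_preimage]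

theorem IsMaximumIntersecting.exists_invariant_line {k : ℕ} (hk : p = 2 → ¬ IsPrimePow k)
    (hF : Nat.card F = p ^ k) {S : Set (GammaL p F)}
    (hS : IsMaximumIntersecting (NonzeroVec F) S) (hone : 1 ∈ S) :
    ∃ v ≠ 0, ∀ g ∈ S, ∃ a : Fˣ, semilin g v = a • v := by
  obtain ⟨v, hv, h | h⟩ := hS.exists_forall_fixesLine hk hF hone
  · exact ⟨v, hv, fun g hg => FixesLine.exists_semilin_eq h hg⟩
  · refine ⟨v, hv, fun g hg => ?_⟩
    obtain ⟨a, ha⟩ := FixesLine.exists_semilin_eq h (g := detTwist g)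
      (by rwa [Set.mem_preimage, detTwist_involutive g])
    rw [semilin_detTwist, inv_smul_eq_iff, smul_smul] at ha
    exact ⟨_, ha⟩

theorem phiPow_mem_transporter (j : ℕ) :
    phiPow p F j ∈ transporter (frobGen p F ^ j) e₁ e₁ := by
  refine ⟨rfl, ?_⟩
  change (1 : Matrix (Fin 2) (Fin 2) F) *ᵥ (frobGen p F ^ j • e₁) = e₁
  rw [Matrix.one_mulVec, smul_e₁]

theorem mem_upperTriangular_iff {g : GammaL p F} :
    g ∈ upperTriangular p F ↔ ∃ a : Fˣ, semilin g e₁ = a • e₁ := by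
  constructor
  · rintro ⟨a, y, z, j, rfl⟩
    exact ⟨a, (mul_mem_transporter (mem_transporter_one_e₁_iff.mpr ⟨y, z, rfl⟩)
      (phiPow_mem_transporter j)).2⟩
  · rintro ⟨a, ha⟩
    obtain ⟨j, hj⟩ := (isOfFinOrder_of_finite _).mem_powers_iff_mem_zpowers.mpr
      (mem_zpowers_frobGen g.right)
    have hmem : g * (phiPow p F j)⁻¹ ∈ transporter 1 e₁ (a • e₁) := by
      have hg : g ∈ transporter (frobGen p F ^ j) e₁ (a • e₁) := ⟨hj.symm, ha⟩
      simpa only [mul_inv_cancel] using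
        mul_mem_transporter hg (inv_mem_transporter (phiPow_mem_transporter j))
    obtain ⟨y, z, h⟩ := mem_transporter_one_e₁_iff.mp hmem
    exact ⟨a, y, z, j, eq_mul_of_mul_inv_eq h⟩

theorem detTwist_mem_upperTriangular {g : GammaL p F} (hg : g ∈ upperTriangular p F) :
    detTwist g ∈ upperTriangular p F := by
  obtain ⟨a, ha⟩ := mem_upperTriangular_iff.mp hg
  exact mem_upperTriangular_iff.mpr
    ⟨g.left.det⁻¹ * a, by rw [semilin_detTwist, ha, smul_smul]⟩

theorem preimage_detTwist_subset_upperTriangular_iff {S : Set (GammaL p F)} :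
    detTwist ⁻¹' S ⊆ upperTriangular p F ↔ S ⊆ upperTriangular p F := by
  have key {T : Set (GammaL p F)} (hT : T ⊆ upperTriangular p F) :
      detTwist ⁻¹' T ⊆ upperTriangular p F := fun g hg =>
    detTwist_involutive g ▸ detTwist_mem_upperTriangular (hT hg)
  exact ⟨fun h => preimage_detTwist_preimage S ▸ key h, key⟩

theorem det₂_e₁_eq_zero_of_fixesLine {S : Set (GammaL p F)} (hS : S ⊆ upperTriangular p F)
    {v : Fin 2 → F} {σ : FrobGroup p F} (h : FixesLine v S σ) : det₂ e₁ v = 0 := by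
  obtain ⟨a, ha⟩ := h
  by_contra hdet
  have hdet' : det₂ (e₁ + v) (a • v) ≠ 0 := by
    have hadd : det₂ (e₁ + v) (a • v) = a * det₂ e₁ v := by
      simp only [det₂, Units.smul_def, Pi.add_apply, Pi.smul_apply, smul_eq_mul]
      ring
    rw [hadd]
    exact mul_ne_zero a.ne_zero hdet
  obtain ⟨g, hg, hge, hgv⟩ := exists_semilin_pair σ hdet hdet'
  have hmem : g ∈ fiber S σ := ha ▸ ⟨hg, hgv⟩
  obtain ⟨b, hb⟩ := mem_upperTriangular_iff.mp (hS hmem.1)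
  refine hdet ?_
  rw [eq_sub_of_add_eq' (hge.symm.trans hb)]
  simp [det₂, Units.smul_def]

theorem IsMaximumIntersecting.forall_fixesLine_e₁ {k : ℕ} (hk : p = 2 → ¬ IsPrimePow k)
    (hF : Nat.card F = p ^ k) {S : Set (GammaL p F)}
    (hS : IsMaximumIntersecting (NonzeroVec F) S) (hone : 1 ∈ S) (hsub : S ⊆ upperTriangular p F) :
    (∀ σ, FixesLine e₁ S σ) ∨ ∀ σ, FixesLine e₁ (detTwist ⁻¹' S) σ := by
  obtain ⟨v, hv, h⟩ := hS.exists_forall_fixesLine hk hF hone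
  have hdet : det₂ e₁ v = 0 := h.elim (fun h => det₂_e₁_eq_zero_of_fixesLine hsub (h 1)) fun h =>
    det₂_e₁_eq_zero_of_fixesLine (preimage_detTwist_subset_upperTriangular_iff.mpr hsub) (h 1)
  obtain ⟨b, rfl⟩ := exists_eq_units_smul_of_det₂_eq_zero e₁_ne_zero hv hdet
  exact h.imp (fun h σ => (h σ).of_units_smul) fun h σ => (h σ).of_units_smul

theorem subset_upperTriangular_of_fixesLine {S : Set (GammaL p F)}
    (h : ∀ σ, FixesLine e₁ S σ) : S ⊆ upperTriangular p F := fun _ hg =>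
  mem_upperTriangular_iff.mpr (FixesLine.exists_semilin_eq h hg)

theorem IsMaximumIntersecting.image_mul_mul {S : Set (GammaL p F)}
    (hS : IsMaximumIntersecting (NonzeroVec F) S) (x y : GammaL p F) :
    IsMaximumIntersecting (NonzeroVec F) ((fun s => x * s * y) '' S) := by
  rw [isMaximumIntersecting_iff_ncard, isIntersecting_iff_agree] at hS ⊢
  refine ⟨?_, ?_⟩
  · rintro _ ⟨g, hg, rfl⟩ _ ⟨h, hh, rfl⟩
    rw [agree_mul_mul_right_iff, agree_mul_mul_left_iff]
    exact hS.1 g hg h hh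
  · rw [Set.ncard_image_of_injective _ fun _ _ h => by simpa using h, hS.2]

theorem IsMaximumIntersecting.exists_image_subset_upperTriangular {k : ℕ}
    (hk : p = 2 → ¬ IsPrimePow k) (hF : Nat.card F = p ^ k) {S : Set (GammaL p F)}
    (hS : IsMaximumIntersecting (NonzeroVec F) S) (hone : 1 ∈ S) :
    ∃ g, (fun s => g * s * g⁻¹) '' S ⊆ upperTriangular p F := by
  obtain ⟨v, hv, hline⟩ := hS.exists_invariant_line hk hF hone
  obtain ⟨P, hP, hPv⟩ := exists_semilin (1 : FrobGroup p F) hv e₁_ne_zero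
  refine ⟨P, ?_⟩
  rintro _ ⟨s, hs, rfl⟩
  obtain ⟨a, ha⟩ := hline s hs
  refine mem_upperTriangular_iff.mpr ⟨a, ?_⟩
  rw [semilin_mul, semilin_inv_eq_iff.mpr hPv, semilin_mul, ha, semilin_units_smul, hP,
    one_smul, hPv]

theorem IsMaximumIntersecting.exists_conj {k : ℕ} (hk : p = 2 → ¬ IsPrimePow k)
    (hF : Nat.card F = p ^ k) {S : Set (GammaL p F)}
    (hS : IsMaximumIntersecting (NonzeroVec F) S) {f : GammaL p F} (hf : f ∈ S) :
    ∃ g, IsMaximumIntersecting (NonzeroVec F) ((fun s => g * (f⁻¹ * s) * g⁻¹) '' S) ∧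
      1 ∈ (fun s => g * (f⁻¹ * s) * g⁻¹) '' S ∧
      (fun s => g * (f⁻¹ * s) * g⁻¹) '' S ⊆ upperTriangular p F := by
  have hmax := hS.image_mul_mul f⁻¹ 1
  have hone : 1 ∈ (fun s => f⁻¹ * s * 1) '' S := ⟨f, hf, by group⟩
  obtain ⟨g, hg⟩ := hmax.exists_image_subset_upperTriangular hk hF hone
  refine ⟨g, ?_, ⟨f, hf, by group⟩, ?_⟩
  · simpa only [mul_assoc] using hS.image_mul_mul (g * f⁻¹) g⁻¹
  · simpa only [Set.image_image, mul_one] using hg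

/-! ### Vertical and horizontal types -/

theorem exists_pow_mul_eq_pow_mul_pow_iff {G : Type*} [CommGroup G] {ω : G}
    (hω : ∀ x, x ∈ Subgroup.zpowers ω) (m n e : ℕ) :
    (∃ y, ω ^ m * y = ω ^ n * y ^ e) ↔
      (e : ZMod (orderOf ω)) - 1 ∣ (n : ZMod (orderOf ω)) - m := by
  have hzpow (s : ℤ) : ω ^ m * ω ^ s = ω ^ n * (ω ^ s) ^ e ↔
      (n - m : ZMod (orderOf ω)) = (e - 1) * ((-s : ℤ) : ZMod (orderOf ω)) := by
    rw [← zpow_natCast, ← zpow_natCast, ← zpow_natCast, ← zpow_mul, ← zpow_add, ← zpow_add,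
      zpow_eq_zpow_iff_modEq, ← ZMod.intCast_eq_intCast_iff]
    push_cast
    constructor <;> intro h <;> linear_combination -h
  constructor
  · rintro ⟨y, hy⟩
    obtain ⟨s, rfl⟩ := hω y
    exact ⟨_, (hzpow s).mp hy⟩
  · rintro ⟨s, hs⟩
    obtain ⟨s, rfl⟩ := ZMod.intCast_surjective s
    exact ⟨ω ^ (-s), (hzpow (-s)).mpr (by rwa [neg_neg])⟩

/-- The conditions on the exponents of a primitive element in the field of order `p ^ k`. For
`p = 2` they are those of `Admissible`, whose alternative `gcd (j' - j) k = 1` makes the divisor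
a unit of `ZMod (2 ^ k - 1)`. -/
def AdmissibleExponents (p k : ℕ) (r : ℕ → ℕ) : Prop :=
  r 0 = 0 ∧ (∀ j < k, r j ≤ p ^ k - 2) ∧
    ∀ j j', j < j' → j' < k →
      (p : ZMod (p ^ k - 1)) ^ (j' - j) - 1 ∣ (r j' : ZMod (p ^ k - 1)) - r j

theorem isUnit_two_pow_sub_one {k d : ℕ} (h : d.gcd k = 1) :
    IsUnit ((2 : ZMod (2 ^ k - 1)) ^ d - 1) := by
  have hcop : Nat.Coprime (2 ^ d - 1) (2 ^ k - 1) := by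
    rw [Nat.Coprime, Nat.pow_sub_one_gcd_pow_sub_one, h, pow_one]
  simpa [Nat.cast_sub Nat.one_le_two_pow] using (ZMod.isUnit_iff_coprime _ _).mpr hcop

theorem admissible_iff {k : ℕ} {r : ℕ → ℕ} : Admissible k r ↔ AdmissibleExponents 2 k r := by
  refine and_congr_right fun _ => and_congr_right fun _ =>
    forall₄_congr fun j j' _ _ => or_iff_right_of_imp fun h => ?_
  exact (isUnit_two_pow_sub_one h).dvd

theorem scalarAut_mem_transporter_e₁ (a : Fˣ) (σ : FrobGroup p F) :
    scalarAut a σ ∈ transporter σ e₁ (a • e₁) :=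
  ⟨rfl, by rw [semilin_scalarAut, smul_e₁]⟩

theorem crossAgree_transporter_e₁_iff {σ τ : FrobGroup p F} {a b : Fˣ} :
    CrossAgree (transporter σ e₁ (a • e₁)) (transporter τ e₁ (b • e₁)) ↔
      ∃ x : Fˣ, a * σ • x = b * τ • x := by
  constructor
  · intro h
    obtain ⟨v, hv, hagree⟩ :=
      h _ (scalarAut_mem_transporter_e₁ a σ) _ (scalarAut_mem_transporter_e₁ b τ)
    rw [semilin_scalarAut, semilin_scalarAut] at hagree
    obtain ⟨i, hi⟩ := Function.ne_iff.mp hv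
    exact ⟨Units.mk0 (v i) hi, Units.ext (congrFun hagree i)⟩
  · rintro ⟨x, hx⟩ g hg h hh
    refine ⟨x • e₁, (smul_ne_zero_iff_ne x).mpr e₁_ne_zero, ?_⟩
    rw [semilin_units_smul, semilin_units_smul, hg.1, hh.1, hg.2, hh.2, smul_smul, smul_smul,
      mul_comm _ a, mul_comm _ b, hx]

theorem isMaximumIntersecting_iff_of_fiber {k : ℕ} (hF : Nat.card F = p ^ k)
    {S : Set (GammaL p F)} {a : ℕ → Fˣ}
    (hfiber : ∀ j < k, fiber S (frobGen p F ^ j) =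
      transporter (frobGen p F ^ j) e₁ (a j • e₁)) :
    IsMaximumIntersecting (NonzeroVec F) S ↔ ∀ j j', j < j' → j' < k →
      ∃ x : Fˣ, a j * frobGen p F ^ j • x = a j' * frobGen p F ^ j' • x := by
  have hcross (i j : ℕ) (hi : i < k) (hj : j < k) :
      CrossAgree (fiber S (frobGen p F ^ i)) (fiber S (frobGen p F ^ j)) ↔
        ∃ x : Fˣ, a i * frobGen p F ^ i • x = a j * frobGen p F ^ j • x := by
    rw [hfiber i hi, hfiber j hj, crossAgree_transporter_e₁_iff]
  constructor
  · intro hS j j' hlt hj'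
    exact (hcross j j' (hlt.trans hj') hj').mp (hS.1.crossAgree_fiber _ _)
  intro h
  have hint : IsIntersecting (NonzeroVec F) S := isIntersecting_iff_agree.mpr fun g hg f hf => by
    obtain ⟨i, hi, hgi⟩ := exists_frobGen_pow_eq hF g.right
    obtain ⟨j, hj, hfj⟩ := exists_frobGen_pow_eq hF f.right
    have hg' : g ∈ fiber S (frobGen p F ^ i) := ⟨hg, hgi.symm⟩
    have hf' : f ∈ fiber S (frobGen p F ^ j) := ⟨hf, hfj.symm⟩
    obtain hlt | rfl | hlt := lt_trichotomy i j
    · exact (hcross i j hi hj).mpr (h i j hlt hj) g hg' f hf'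
    · exact (hcross i i hi hi).mpr ⟨1, rfl⟩ g hg' f hf'
    · exact ((hcross j i hj hi).mpr (h j i hlt hi) f hf' g hg').symm
  refine isMaximumIntersecting_iff_ncard.mpr ⟨hint, ncard_eq_card_mul_of_fiber fun σ => ?_⟩
  obtain ⟨j, hj, rfl⟩ := exists_frobGen_pow_eq hF σ
  rw [hfiber j hj, ncard_transporter _ e₁_ne_zero ((smul_ne_zero_iff_ne _).mpr e₁_ne_zero)]

theorem one_mem_iff_of_fiber {S : Set (GammaL p F)} {a : Fˣ}
    (hfiber : fiber S 1 = transporter 1 e₁ (a • e₁)) : 1 ∈ S ↔ a = 1 := by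
  have hmem : 1 ∈ S ↔ 1 ∈ fiber S (1 : FrobGroup p F) := ⟨fun h => ⟨h, rfl⟩, fun h => h.1⟩
  rw [hmem, hfiber]
  constructor
  · rintro ⟨-, h⟩
    rw [semilin_one] at h
    exact Units.ext (by simpa [Units.smul_def] using (congrFun h 0).symm)
  · rintro rfl
    exact ⟨rfl, by rw [semilin_one, one_smul]⟩

theorem fixesLine_iff_exists_exponents {k : ℕ} (hF : Nat.card F = p ^ k) {ω : Fˣ}
    (hω : ∀ x : Fˣ, x ∈ Subgroup.zpowers ω) {c : ℕ → Fˣ ≃* Fˣ}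
    (hc : ∀ j j', j < j' → ∀ m n : ℕ,
      (∃ x : Fˣ, c j (ω ^ m) * frobGen p F ^ j • x = c j' (ω ^ n) * frobGen p F ^ j' • x) ↔
        (p : ZMod (p ^ k - 1)) ^ (j' - j) - 1 ∣ (n : ZMod (p ^ k - 1)) - m)
    {S : Set (GammaL p F)} :
    (IsMaximumIntersecting (NonzeroVec F) S ∧ 1 ∈ S ∧ ∀ σ, FixesLine e₁ S σ) ↔
      ∃ r, AdmissibleExponents p k r ∧ ∀ j < k, fiber S (frobGen p F ^ j) =
        transporter (frobGen p F ^ j) e₁ (c j (ω ^ r j) • e₁) := by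
  have horder : orderOf ω = p ^ k - 1 := by
    rw [orderOf_eq_card_of_forall_mem_zpowers hω, Nat.card_units, hF]
  have hcard : 1 < p ^ k := hF ▸ Finite.one_lt_card
  have hk : 0 < k := pos_of_card_eq_pow hF
  have hzero (i : ℕ) (hi : i ≤ p ^ k - 2) : c 0 (ω ^ i) = 1 ↔ i = 0 := by
    rw [map_eq_one_iff _ (c 0).injective, ← pow_zero ω]
    exact (pow_injOn_Iio_orderOf).eq_iff (Set.mem_Iio.mpr (by omega)) (orderOf_pos ω)
  constructor
  · rintro ⟨hmax, hone, hline⟩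
    have hexists (j : ℕ) : ∃ r ≤ p ^ k - 2, fiber S (frobGen p F ^ j) =
        transporter (frobGen p F ^ j) e₁ (c j (ω ^ r) • e₁) := by
      obtain ⟨a, ha⟩ := hline (frobGen p F ^ j)
      obtain ⟨i, hi⟩ := (isOfFinOrder_of_finite ω).mem_powers_iff_mem_zpowers.mpr
        (hω ((c j).symm a))
      have hlt : i % orderOf ω < p ^ k - 1 := horder ▸ Nat.mod_lt _ (orderOf_pos ω)
      refine ⟨i % orderOf ω, by omega, ?_⟩
      rw [ha, pow_mod_orderOf, show ω ^ i = _ from hi, MulEquiv.apply_symm_apply]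
    choose r hr hfiber using hexists
    refine ⟨r, ⟨?_, fun j _ => hr j, fun j j' hlt hj' => ?_⟩, fun j _ => hfiber j⟩
    · exact (hzero _ (hr 0)).mp ((one_mem_iff_of_fiber (by simpa using hfiber 0)).mp hone)
    · exact (hc j j' hlt _ _).mp
        ((isMaximumIntersecting_iff_of_fiber hF fun j _ => hfiber j).mp hmax j j' hlt hj')
  · rintro ⟨r, ⟨hr0, hr, hdvd⟩, hfiber⟩
    refine ⟨?_, ?_, fun σ => ?_⟩
    · exact (isMaximumIntersecting_iff_of_fiber hF hfiber).mpr fun j j' hlt hj' =>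
        (hc j j' hlt _ _).mpr (hdvd j j' hlt hj')
    · exact (one_mem_iff_of_fiber (by simpa using hfiber 0 hk)).mpr ((hzero _ (hr 0 hk)).mpr hr0)
    · obtain ⟨j, hj, rfl⟩ := exists_frobGen_pow_eq hF σ
      exact ⟨_, hfiber j hj⟩

theorem mem_transporter_e₁_iff {X g : GammaL p F} {σ : FrobGroup p F} {u : Fin 2 → F}
    (hX : X ∈ transporter σ e₁ u) (a : Fˣ) :
    g ∈ transporter σ e₁ ((σ • a) • u) ↔ ∃ y z, g = X * ofGL p (upper a y z) := by
  have hXa : semilin X (a • e₁) = (σ • a) • u := by rw [semilin_units_smul, hX.1, hX.2]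
  have htranslate := mul_mem_transporter_iff (g := X⁻¹ * g) (σ := 1) hX.1 e₁ (a • e₁)
  rw [mul_inv_cancel_left, mul_one, hXa] at htranslate
  simp only [htranslate, mem_transporter_one_e₁_iff, inv_mul_eq_iff_eq_mul]

theorem V_eq_transporter (ω : Fˣ) (i j : ℕ) :
    V p ω i j = transporter (frobGen p F ^ j) e₁ (ω ^ i • e₁) := by
  have hX : ofGL p (Matrix.GeneralLinearGroup.scalar (Fin 2) (ω ^ i)) * phiPow p F j ∈
      transporter (frobGen p F ^ j) e₁ (ω ^ i • e₁) := by
    have hscalar : ofGL p (Matrix.GeneralLinearGroup.scalar (Fin 2) (ω ^ i)) ∈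
        transporter 1 e₁ (ω ^ i • e₁) := scalarAut_mem_transporter_e₁ (ω ^ i) 1
    simpa only [one_mul] using mul_mem_transporter hscalar (phiPow_mem_transporter j)
  ext g
  have h := mem_transporter_e₁_iff (g := g) hX 1
  rw [smul_one, one_smul] at h
  rw [h, exists_comm]
  rfl

theorem detTwist_phiPow (j : ℕ) : detTwist (phiPow p F j) = phiPow p F j := by
  simp only [detTwist, phiPow, SemidirectProduct.map_inr, MonoidHom.id_apply]

theorem detTwist_ofGL_upper (x y : Fˣ) (z : F) :
    detTwist (ofGL p (upper x y z)) = ofGL p (upper y⁻¹ x⁻¹ ((x * y)⁻¹.val * z)) := by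
  have hdet : (upper x y z).det = x * y := Units.ext <| by
    simp [upper, Matrix.det_fin_two_of]
  simp only [detTwist, ofGL, SemidirectProduct.map_inl]
  congr 1
  change Matrix.GeneralLinearGroup.scalar (Fin 2) (upper x y z).det⁻¹ * upper x y z = _
  refine Units.ext ?_
  rw [hdet]
  change Matrix.scalar (Fin 2) (x * y)⁻¹.val * !![x.val, z; 0, y.val] =
    !![y⁻¹.val, (x * y)⁻¹.val * z; 0, x⁻¹.val]
  rw [Matrix.scalar_apply, ← Matrix.smul_eq_diagonal_mul]
  ext i j
  fin_cases i <;> fin_cases j <;> simp [mul_right_comm]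

theorem H_eq_preimage_transporter (ω : Fˣ) (t j : ℕ) :
    H p ω t j =
      detTwist ⁻¹' transporter (frobGen p F ^ j) e₁ ((frobGen p F ^ j • ω ^ t)⁻¹ • e₁) := by
  ext g
  rw [Set.mem_preimage, ← smul_inv', mem_transporter_e₁_iff (phiPow_mem_transporter j)]
  constructor
  · rintro ⟨x, z, rfl⟩
    exact ⟨_, _, by rw [map_mul, detTwist_phiPow, detTwist_ofGL_upper]⟩
  · rintro ⟨y, z, hg⟩
    have hgg := congrArg detTwist hg
    rw [detTwist_involutive, map_mul, detTwist_phiPow, detTwist_ofGL_upper, inv_inv] at hgg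
    exact ⟨_, _, hgg⟩

theorem eq_iUnion_iff_forall_fiber_eq {k : ℕ} (hF : Nat.card F = p ^ k) {S : Set (GammaL p F)}
    {A : ℕ → Set (GammaL p F)} (hA : ∀ j, ∀ g ∈ A j, g.right = frobGen p F ^ j) :
    S = ⋃ j ∈ Finset.range k, A j ↔ ∀ j < k, fiber S (frobGen p F ^ j) = A j := by
  constructor
  · rintro rfl j hj
    ext g
    simp only [fiber, Set.mem_ofPred_eq, Set.mem_iUnion, Finset.mem_range, exists_prop]
    constructor
    · rintro ⟨⟨i, hi, hg⟩, hright⟩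
      rwa [← (frobGen_pow_inj hF hi hj).mp ((hA i g hg).symm.trans hright)]
    · exact fun hg => ⟨⟨j, hj, hg⟩, hA j g hg⟩
  · intro h
    ext g
    simp only [Set.mem_iUnion, Finset.mem_range, exists_prop]
    constructor
    · intro hg
      obtain ⟨j, hj, hright⟩ := exists_frobGen_pow_eq hF g.right
      exact ⟨j, hj, h j hj ▸ ⟨hg, hright.symm⟩⟩
    · rintro ⟨j, hj, hg⟩
      exact (h j hj ▸ hg : g ∈ fiber S _).1

variable (p) in
/-- The vertical type in the field of order `p ^ k`. -/
def IsVertical (k : ℕ) (ω : Fˣ) (S : Set (GammaL p F)) : Prop :=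
  ∃ r : ℕ → ℕ, AdmissibleExponents p k r ∧ S = ⋃ j ∈ Finset.range k, V p ω (r j) j

variable (p) in
/-- The horizontal type in the field of order `p ^ k`. -/
def IsHorizontal (k : ℕ) (ω : Fˣ) (S : Set (GammaL p F)) : Prop :=
  ∃ t : ℕ → ℕ, AdmissibleExponents p k t ∧ S = ⋃ j ∈ Finset.range k, H p ω (t j) j

theorem isVerticalType_iff {F : Type*} [Field F] [Finite F] [CharP F 2] {k : ℕ} {ω : Fˣ}
    {S : Set (GammaL 2 F)} : IsVerticalType k ω S ↔ IsVertical 2 k ω S :=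
  exists_congr fun _ => and_congr_left' admissible_iff

theorem isHorizontalType_iff {F : Type*} [Field F] [Finite F] [CharP F 2] {k : ℕ} {ω : Fˣ}
    {S : Set (GammaL 2 F)} : IsHorizontalType k ω S ↔ IsHorizontal 2 k ω S :=
  exists_congr fun _ => and_congr_left' admissible_iff

theorem exists_pow_mul_eq_iff_dvd {k : ℕ} (hF : Nat.card F = p ^ k) {ω : Fˣ}
    (hω : ∀ x : Fˣ, x ∈ Subgroup.zpowers ω) (m n d : ℕ) :
    (∃ y : Fˣ, ω ^ m * y = ω ^ n * frobGen p F ^ d • y) ↔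
      (p : ZMod (p ^ k - 1)) ^ d - 1 ∣ (n : ZMod (p ^ k - 1)) - m := by
  have hdvd := exists_pow_mul_eq_pow_mul_pow_iff hω m n (p ^ d)
  rw [orderOf_eq_card_of_forall_mem_zpowers hω, Nat.card_units, hF, Nat.cast_pow] at hdvd
  simpa only [frobGen_pow_smul_units] using hdvd

theorem isVertical_iff {k : ℕ} (hF : Nat.card F = p ^ k) {ω : Fˣ}
    (hω : ∀ x : Fˣ, x ∈ Subgroup.zpowers ω) {S : Set (GammaL p F)} :
    IsVertical p k ω S ↔
      IsMaximumIntersecting (NonzeroVec F) S ∧ 1 ∈ S ∧ ∀ σ, FixesLine e₁ S σ := by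
  have hrefl (j j' : ℕ) (hlt : j < j') (m n : ℕ) :
      (∃ x : Fˣ, MulEquiv.refl Fˣ (ω ^ m) * frobGen p F ^ j • x =
          MulEquiv.refl Fˣ (ω ^ n) * frobGen p F ^ j' • x) ↔
        (p : ZMod (p ^ k - 1)) ^ (j' - j) - 1 ∣ (n : ZMod (p ^ k - 1)) - m := by
    obtain ⟨d, rfl⟩ := Nat.exists_eq_add_of_le hlt.le
    rw [add_tsub_cancel_left, ← exists_pow_mul_eq_iff_dvd hF hω]
    refine ((MulAction.surjective (frobGen p F ^ j)).exists.trans (exists_congr fun x => ?_)).symm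
    rw [smul_smul, ← pow_add, add_comm d]
    rfl
  rw [fixesLine_iff_exists_exponents hF hω hrefl]
  refine exists_congr fun r => and_congr_right fun _ => ?_
  simp only [V_eq_transporter, MulEquiv.refl_apply]
  exact eq_iUnion_iff_forall_fiber_eq hF fun _ _ hg => hg.1

theorem isHorizontal_iff {k : ℕ} (hF : Nat.card F = p ^ k) {ω : Fˣ}
    (hω : ∀ x : Fˣ, x ∈ Subgroup.zpowers ω) {S : Set (GammaL p F)} :
    IsHorizontal p k ω S ↔
      IsMaximumIntersecting (NonzeroVec F) S ∧ 1 ∈ S ∧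
        ∀ σ, FixesLine e₁ (detTwist ⁻¹' S) σ := by
  let c (j : ℕ) : Fˣ ≃* Fˣ :=
    (MulDistribMulAction.toMulEquiv Fˣ (frobGen p F ^ j)).trans (MulEquiv.inv Fˣ)
  have hcapply (j : ℕ) (a : Fˣ) : c j a = (frobGen p F ^ j • a)⁻¹ := rfl
  have hc (j j' : ℕ) (hlt : j < j') (m n : ℕ) :
      (∃ x, c j (ω ^ m) * frobGen p F ^ j • x = c j' (ω ^ n) * frobGen p F ^ j' • x) ↔
        (p : ZMod (p ^ k - 1)) ^ (j' - j) - 1 ∣ (n : ZMod (p ^ k - 1)) - m := by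
    obtain ⟨d, rfl⟩ := Nat.exists_eq_add_of_le hlt.le
    rw [add_tsub_cancel_left, dvd_sub_comm, ← exists_pow_mul_eq_iff_dvd hF hω]
    refine (Equiv.mulLeft (ω ^ n)).surjective.exists.trans (exists_congr fun y => ?_)
    rw [Equiv.coe_mulLeft, hcapply, hcapply, ← smul_inv', ← smul_inv', ← smul_mul', ← smul_mul',
      inv_mul_cancel_left, pow_add, mul_smul, smul_left_cancel_iff, inv_mul_eq_iff_eq_mul]
  have htwist : IsMaximumIntersecting (NonzeroVec F) S ∧ 1 ∈ S ↔
      IsMaximumIntersecting (NonzeroVec F) (detTwist ⁻¹' S) ∧ 1 ∈ detTwist ⁻¹' S := by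
    rw [isMaximumIntersecting_preimage_detTwist_iff, Set.mem_preimage, map_one]
  rw [← and_assoc, htwist, and_assoc, fixesLine_iff_exists_exponents hF hω hc]
  refine exists_congr fun t => and_congr_right fun _ => ?_
  simp only [H_eq_preimage_transporter, hcapply]
  rw [eq_iUnion_iff_forall_fiber_eq hF fun _ _ hg => hg.1]
  refine forall₂_congr fun j _ => ?_
  rw [fiber_preimage_detTwist, ← (Set.preimage_injective.mpr detTwist_involutive.surjective).eq_iff,
    preimage_detTwist_preimage]

theorem isMaximumIntersecting_upperTriangular_iff {k : ℕ} (hk : p = 2 → ¬ IsPrimePow k)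
    (hF : Nat.card F = p ^ k) {ω : Fˣ} (hω : ∀ x : Fˣ, x ∈ Subgroup.zpowers ω)
    {S : Set (GammaL p F)} :
    (IsMaximumIntersecting (NonzeroVec F) S ∧ 1 ∈ S ∧ S ⊆ upperTriangular p F) ↔
      IsVertical p k ω S ∨ IsHorizontal p k ω S := by
  rw [isVertical_iff hF hω, isHorizontal_iff hF hω, ← and_or_left, ← and_or_left]
  refine and_congr_right fun hS => and_congr_right fun hone =>
    ⟨hS.forall_fixesLine_e₁ hk hF hone, ?_⟩
  rintro (h | h)
  · exact subset_upperTriangular_of_fixesLine h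
  · exact preimage_detTwist_subset_upperTriangular_iff.mp (subset_upperTriangular_of_fixesLine h)

end Semilinear

end SemilinearEKR

open SemilinearEKR in
theorem theorem3_general (p k : ℕ) [Fact p.Prime] (hk : p = 2 → ¬ IsPrimePow k) (F : Type*)
    [Field F] [Finite F] [CharP F p] (hF : Nat.card F = p ^ k) :
    HasEKR (GammaL p F) (NonzeroVec F) ∧
    IsGreatest {n : ℕ | ∃ S : Set (GammaL p F), IsIntersecting (NonzeroVec F) S ∧ S.ncard = n}
      (k * p ^ k * (p ^ k - 1)) ∧
    ∀ ω : Fˣ, (∀ x : Fˣ, x ∈ Subgroup.zpowers ω) →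
      (∀ S : Set (GammaL p F), IsMaximumIntersecting (NonzeroVec F) S → ∀ f ∈ S,
        ∃ g : GammaL p F,
          IsVertical p k ω ((fun s => g * (f⁻¹ * s) * g⁻¹) '' S) ∨
          IsHorizontal p k ω ((fun s => g * (f⁻¹ * s) * g⁻¹) '' S)) ∧
      (∀ S : Set (GammaL p F),
        (IsMaximumIntersecting (NonzeroVec F) S ∧ 1 ∈ S ∧ S ⊆ upperTriangular p F) ↔
          (IsVertical p k ω S ∨ IsHorizontal p k ω S)) := by
  refine ⟨hasEKR_GammaL, ?_, fun ω hω => ⟨fun S hS f hf => ?_, fun S =>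
    isMaximumIntersecting_upperTriangular_iff hk hF hω⟩⟩
  · simpa only [maxCard, card_frobGroup hF, hF, ← mul_assoc] using
      isGreatest_maxCard (p := p) (F := F)
  · obtain ⟨g, hg⟩ := hS.exists_conj hk hF hf
    exact ⟨g, (isMaximumIntersecting_upperTriangular_iff hk hF hω).mp hg⟩

theorem theorem3 (k : ℕ) (hk : ¬ IsPrimePow k) (F : Type*) [Field F] [Finite F] [CharP F 2]
    (hF : Nat.card F = 2 ^ k) :
    SemilinearEKR.HasEKR (SemilinearEKR.GammaL 2 F) (SemilinearEKR.NonzeroVec F) ∧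
    IsGreatest {n : ℕ | ∃ S : Set (SemilinearEKR.GammaL 2 F),
        SemilinearEKR.IsIntersecting (SemilinearEKR.NonzeroVec F) S ∧ S.ncard = n}
      (k * 2 ^ k * (2 ^ k - 1)) ∧
    ∀ ω : Fˣ, (∀ x : Fˣ, x ∈ Subgroup.zpowers ω) →
      (∀ S : Set (SemilinearEKR.GammaL 2 F),
        SemilinearEKR.IsMaximumIntersecting (SemilinearEKR.NonzeroVec F) S → ∀ f ∈ S,
          ∃ g : SemilinearEKR.GammaL 2 F,
            SemilinearEKR.IsVerticalType k ω ((fun s => g * (f⁻¹ * s) * g⁻¹) '' S) ∨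
            SemilinearEKR.IsHorizontalType k ω ((fun s => g * (f⁻¹ * s) * g⁻¹) '' S)) ∧
      (∀ S : Set (SemilinearEKR.GammaL 2 F),
        (SemilinearEKR.IsMaximumIntersecting (SemilinearEKR.NonzeroVec F) S ∧
            1 ∈ S ∧ S ⊆ SemilinearEKR.upperTriangular 2 F) ↔
          (SemilinearEKR.IsVerticalType k ω S ∨ SemilinearEKR.IsHorizontalType k ω S)) := by
  simpa only [SemilinearEKR.isVerticalType_iff, SemilinearEKR.isHorizontalType_iff] using
    theorem3_general 2 k (fun _ => hk) F hF
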